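/- **Conventions.** A *mixed graph* $G$ has a finite vertex set $V(G)$ and undirected and directed edges, and its underlying graph is simple (no loops, and at most one edge, undirected or directed, between any two vertices). An *orientable path* from $x$ to $y$ is a sequence of distinct vertices $x=x_1,x_2,\dots,x_k=y$ such that for each $1\le i<k$ there is an undirected edge $x_ix_{i+1}$ or a directed edge from $x_i$ to $x_{i+1}$; its length is $k-1$. $G$ is *connected* if for all $x,y\in V(G)$ there are orientable paths from $x$ to $y$ and from $y$ to $x$; a *bridge* is an undirected edge $e$ such that the underlying graph of $G-e$ is disconnected; $G$ is *bridgeless* if it is connected and has no bridge. $G$ is *undirected* if it has no directed edge. It is *equal-partition bipartite* if $V(G)$ is the disjoint union of sets $A,B$ with $|A|=|B|$ such that every edge (undirected or directed) joins a vertex of $A$ and a vertex of $B$. For a vertex $v$, let $d_G^*(v)$, $d_G^+(v)$, $d_G^-(v)$ be the numbers of undirected edges at $v$, of directed edges leaving $v$ and of directed edges entering $v$, and let $\Delta^*=\Delta^*(G)=\max_v d^*_G(v)$. The distance from $x$ to $y$ is the least length of an orientable path from $x$ to $y$, and the diameter is the maximum of the distances over all ordered pairs of vertices. A *strong orientation*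 of $G$ is a connected directed graph obtained by giving each undirected edge of $G$ a direction. The *oriented diameter* $\overrightarrow{\mathrm{diam}}(G)$ is the minimum of the diameters of the strong orientations of $G$. **Corollary 1.6.** Every bridgeless mixed equal-partition bipartite graph $G$ of order $n$ with maximum undirected degree $\Delta^*$ has a strong orientation, and $$\overrightarrow{\mathrm{diam}}(G)\le\begin{cases} n-2\Delta^*+7, & \text{if } G \text{ is undirected};\\ n-2\Delta^*+8, & \text{if } G \text{ has a vertex } u \text{ with } d_G^*(u)=\Delta^* \text{ and } d_G^+(u)+d_G^-(u)\ge 2;\\ n-2\Delta^*+10, & \text{otherwise}.\end{cases}$$ -/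

import Mathlib

/-- A mixed graph on the vertex set `V` whose underlying graph is simple: the undirected edges form
a simple graph `edge`, `arc x y` says that there is a directed edge from `x` to `y`, there is no
directed loop, and two vertices are joined by at most one edge, undirected or directed. -/
@[ext]
structure MixedGraph (V : Type*) where
  edge : SimpleGraph V
  arc : V → V → Prop
  arc_irrefl : ∀ x, ¬ arc x x
  arc_asymm : ∀ x y, arc x y → ¬ arc y x
  not_edge_of_arc : ∀ x y, arc x y → ¬ edge.Adj x y

namespace MixedGraph

/-- One can step from `x` to `y` along an undirected edge `xy` or a directed edge from `x` to
`y`. -/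
def Step {V : Type*} (G : MixedGraph V) (x y : V) : Prop :=
  G.edge.Adj x y ∨ G.arc x y

/-- The list `l` is an orientable path from `x` to `y`: a sequence of distinct vertices with first
entry `x`, last entry `y`, in which consecutive vertices are joined by a step. -/
def IsOrientablePath {V : Type*} (G : MixedGraph V) (x y : V) (l : List V) : Prop :=
  l.head? = some x ∧ l.getLast? = some y ∧ l.Nodup ∧ l.IsChain G.Step

/-- Any two vertices are joined by orientable paths in both directions. -/
def IsConnected {V : Type*} (G : MixedGraph V) : Prop :=
  ∀ x y : V, ∃ l : List V, G.IsOrientablePath x y l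

/-- The underlying simple graph. -/
def underlying {V : Type*} (G : MixedGraph V) : SimpleGraph V where
  Adj x y := G.edge.Adj x y ∨ G.arc x y ∨ G.arc y x
  symm := ⟨by
    rintro x y (h | h | h)
    · exact Or.inl h.symm
    · exact Or.inr (Or.inr h)
    · exact Or.inr (Or.inl h)⟩
  loopless := ⟨by
    rintro x (h | h | h)
    · exact G.edge.irrefl h
    · exact G.arc_irrefl x h
    · exact G.arc_irrefl x h⟩

/-- The mixed graph obtained by removing the undirected edge `e`. -/
def deleteEdge {V : Type*} (G : MixedGraph V) (e : Sym2 V) : MixedGraph V where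
  edge := G.edge.deleteEdges {e}
  arc := G.arc
  arc_irrefl := G.arc_irrefl
  arc_asymm := G.arc_asymm
  not_edge_of_arc x y h h' := G.not_edge_of_arc x y h (SimpleGraph.deleteEdges_le {e} h')

/-- A bridge is an undirected edge whose removal disconnects the (underlying) graph. -/
def IsBridge {V : Type*} (G : MixedGraph V) (e : Sym2 V) : Prop :=
  e ∈ G.edge.edgeSet ∧ ¬ (G.deleteEdge e).underlying.Connected

/-- A mixed graph is bridgeless if it is connected (by orientable paths in both directions) and has
no bridge. -/
def IsBridgeless {V : Type*} (G : MixedGraph V) : Prop :=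
  G.IsConnected ∧ ∀ e : Sym2 V, ¬ G.IsBridge e

/-- There are no directed edges. -/
def IsUndirected {V : Type*} (G : MixedGraph V) : Prop :=
  ∀ x y : V, ¬ G.arc x y

/-- There are no undirected edges. -/
def IsDirected {V : Type*} (G : MixedGraph V) : Prop :=
  ∀ x y : V, ¬ G.edge.Adj x y

/-- The number of undirected edges at `x`. -/
noncomputable def undirDegree {V : Type*} (G : MixedGraph V) (x : V) : ℕ :=
  {y | G.edge.Adj x y}.ncard

/-- The number of directed edges leaving `x`. -/
noncomputable def outDegree {V : Type*} (G : MixedGraph V) (x : V) : ℕ :=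
  {y | G.arc x y}.ncard

/-- The number of directed edges entering `x`. -/
noncomputable def inDegree {V : Type*} (G : MixedGraph V) (x : V) : ℕ :=
  {y | G.arc y x}.ncard

/-- The maximum undirected degree. -/
noncomputable def maxUndirDegree {V : Type*} [Fintype V] (G : MixedGraph V) : ℕ :=
  Finset.univ.sup G.undirDegree

/-- The vertex set is the disjoint union of two sets of the same size, and every edge, undirected
or directed, joins a vertex of one set to a vertex of the other. -/
def IsEqualPartitionBipartite {V : Type*} (G : MixedGraph V) : Prop :=
  ∃ A B : Set V, G.underlying.IsBipartiteWith A B ∧ A ∪ B = Set.univ ∧ A.ncard = B.ncard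

/-- The distance from `x` to `y`: the least number of edges of an orientable path from `x` to `y`,
with value `⊤` if there is none. -/
noncomputable def dist {V : Type*} (G : MixedGraph V) (x y : V) : ℕ∞ :=
  ⨅ (k : ℕ) (_ : ∃ l : List V, G.IsOrientablePath x y l ∧ l.length = k + 1), (k : ℕ∞)

/-- The diameter: the largest distance from a vertex to a vertex. -/
noncomputable def diam {V : Type*} (G : MixedGraph V) : ℕ∞ :=
  ⨆ (x : V) (y : V), G.dist x y

/-- `D` arises from `G` by giving every undirected edge of `G` a direction. (Exactly one direction,
because `D` has at most one edge between two vertices.) -/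
structure IsOrientation {V : Type*} (D G : MixedGraph V) : Prop where
  isDirected : D.IsDirected
  arc_of_arc : ∀ x y, G.arc x y → D.arc x y
  arc_of_edge : ∀ x y, G.edge.Adj x y → D.arc x y ∨ D.arc y x
  of_arc : ∀ x y, D.arc x y → G.arc x y ∨ G.edge.Adj x y

/-- A strong orientation is an orientation that is connected as a directed graph. -/
def IsStrongOrientation {V : Type*} (D G : MixedGraph V) : Prop :=
  D.IsOrientation G ∧ D.IsConnected

/-- The oriented diameter: the least diameter of a strong orientation, with value `⊤` if there is
no strong orientation. -/
noncomputable def orientedDiam {V : Type*} (G : MixedGraph V) : ℕ∞ :=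
  ⨅ (D : MixedGraph V) (_ : D.IsStrongOrientation G), D.diam

end MixedGraph

/-! Let `u` be a vertex, `N` the set of its undirected neighbours and `A` the part not containing
`u`, so that `N` lies in `A` and `|A| = n/2`. A path alternates between the two parts, so its length
is at most twice the number of vertices of `A` on it. A path that meets `N` in at most `k` vertices
therefore has length at most `2(|A| - |N| + k)`, which is `n - 2Δ* + 2k` if `u` has maximum
undirected degree. It remains to find a strong orientation in which any two vertices are joined
through few vertices of `N`.

Mixed graphs. Start from any strong orientation (Boesch and Tindell) and redirect only the
undirected edges at `u`: the vertices of a set `Q ⊆ N` point into `u`, the rest of `N` is entered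
from `u`. `Q` is taken maximal such that each of its vertices can still be reached from `u` cheaply
(`Hub.IsSplit`). If a vertex outside `Q` cannot be added, then either it cannot be entered cheaply
itself, or it is the supplier of some vertex of `Q` and so leads straight to `Q`. This gives at most
three vertices of `N` on the way to `u` and two on the way back, hence `k = 5`. If two directed
edges of the graph meet `u`, a walk that needs all five can be chosen to miss an end of one of them;
this end lies in `A \ N`, so the effect is that of `k = 4` (`Hub.IsSplit.balanced`).

Undirected graphs. Here the orientation is designed from the components of the graph without `u` and
`N`. Colour `N` by a set `I`, direct edges from `u` to `I` and from `N \ I` to `u`, and let every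
component with attachments of both colours be entered from `I` and left to `N \ I`. If each vertex
of `N` is attached to such a mixed component, this extends to a strong orientation, with two
vertices of `N` on each way, so `k = 4`. One more unit is saved by parity if an end of the path lies
in `A`. Otherwise the only expensive pairs are a component attached to `I` only and one attached to
`N \ I` only, and `exists_isColoring` chooses `I` so that such a pair misses a vertex of `A` or has
a shortcut. -/

open Relation

/-! ### Walks within a set of vertices -/

/-- There is a walk along `r` from `x` to `y` all of whose vertices lie in `X`. -/
def ReachIn {V : Type*} (r : V → V → Prop) (X : Set V) (x y : V) : Prop :=
  x ∈ X ∧ ReflTransGen (fun a b => r a b ∧ b ∈ X) x y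

/-- There is a nonempty walk along `r` from `x` to `y` all of whose inner vertices lie in `X`. -/
def Via {V : Type*} (r : V → V → Prop) (X : Set V) (x y : V) : Prop :=
  ∃ c, ReflTransGen (fun a b => r a b ∧ b ∈ X) x c ∧ r c y

section Walks

variable {V : Type*} {r r' : V → V → Prop} {X Y : Set V} {x y z m : V}

theorem ReachIn.refl (h : x ∈ X) : ReachIn r X x x := ⟨h, .refl⟩

theorem ReachIn.mono (h : ReachIn r X x y) (hXY : X ⊆ Y) : ReachIn r Y x y :=
  ⟨hXY h.1, ReflTransGen.mono (fun _ _ hab => ⟨hab.1, hXY hab.2⟩) _ _ h.2⟩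

theorem ReachIn.trans (h : ReachIn r X x y) (h' : ReachIn r X y z) : ReachIn r X x z :=
  ⟨h.1, h.2.trans h'.2⟩

theorem ReachIn.union_trans (h : ReachIn r X x y) (h' : ReachIn r Y y z) :
    ReachIn r (X ∪ Y) x z :=
  (h.mono Set.subset_union_left).trans (h'.mono Set.subset_union_right)

theorem ReachIn.single (hx : x ∈ X) (hy : y ∈ X) (h : r x y) : ReachIn r X x y :=
  ⟨hx, .single ⟨h, hy⟩⟩

theorem Via.single (h : r x y) : Via r X x y := ⟨x, .refl, h⟩

theorem Via.mono (h : Via r X x y) (hXY : X ⊆ Y) : Via r Y x y := by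
  obtain ⟨c, hc, h⟩ := h
  exact ⟨c, ReflTransGen.mono (fun _ _ hab => ⟨hab.1, hXY hab.2⟩) _ _ hc, h⟩

theorem Via.reachIn (h : Via r X x y) (hx : x ∈ X) (hy : y ∈ X) : ReachIn r X x y := by
  obtain ⟨c, hc, h⟩ := h
  exact ⟨hx, hc.tail ⟨h, hy⟩⟩

theorem Via.trans (h : Via r X x m) (hm : m ∈ X) (h' : Via r X m y) : Via r X x y := by
  obtain ⟨c, hc, h⟩ := h
  obtain ⟨c', hc', h'⟩ := h'
  exact ⟨c', (hc.tail ⟨h, hm⟩).trans hc', h'⟩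

theorem Via.cons (h : r x m) (hm : m ∈ X) (h' : Via r X m y) : Via r X x y :=
  Via.trans (Via.single h) hm h'

theorem Via.snoc (h : Via r X x m) (hm : m ∈ X) (h' : r m y) : Via r X x y :=
  Via.trans h hm (Via.single h')

/-- Change the relation, provided that it stays the same on the vertices which occur. -/
theorem Via.congr_rel (h : Via r X x y)
    (hr : ∀ a b, (a = x ∨ a ∈ X) → (b = y ∨ b ∈ X) → r a b → r' a b) : Via r' X x y := by
  obtain ⟨c, hc, h⟩ := h
  have key : ReflTransGen (fun a b => r' a b ∧ b ∈ X) x c ∧ (c = x ∨ c ∈ X) := by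
    clear h
    induction hc with
    | refl => exact ⟨.refl, .inl rfl⟩
    | tail _ h ih => exact ⟨ih.1.tail ⟨hr _ _ ih.2 (.inr h.2) h.1, h.2⟩, .inr h.2⟩
  exact ⟨c, key.1, hr _ _ key.2 (.inl rfl) h⟩

/-- A walk either avoids `m` or visits it a last time. -/
theorem Via.split_last (h : Via r X x y) (m : V) :
    Via r (X \ {m}) x y ∨ (Via r X x m ∧ Via r (X \ {m}) m y) := by
  obtain ⟨c, hc, h⟩ := h
  have key : ReflTransGen (fun a b => r a b ∧ b ∈ X \ {m}) x c ∨
      (Via r X x m ∧ ReflTransGen (fun a b => r a b ∧ b ∈ X \ {m}) m c) := by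
    clear h
    induction hc with
    | refl => exact .inl .refl
    | @tail b c hb h ih =>
      by_cases hcm : c = m
      · subst hcm
        exact .inr ⟨⟨b, hb, h.1⟩, .refl⟩
      · rcases ih with ih | ih
        · exact .inl (ih.tail ⟨h.1, h.2, hcm⟩)
        · exact .inr ⟨ih.1, ih.2.tail ⟨h.1, h.2, hcm⟩⟩
  rcases key with key | key
  · exact .inl ⟨c, key, h⟩
  · exact .inr ⟨key.1, c, key.2, h⟩

/-- The first visit of a set on a walk that ends in this set. -/
theorem exists_first_visit (h : ReflTransGen r x y) (hx : x ∈ X) (hy : y ∉ X) :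
    ∃ z, z ∉ X ∧ Via r X x z := by
  have key : ∀ c, ReflTransGen r x c → (∃ z, z ∉ X ∧ Via r X x z) ∨
      (c ∈ X ∧ ReflTransGen (fun a b => r a b ∧ b ∈ X) x c) := by
    intro c hc
    induction hc with
    | refl => exact .inr ⟨hx, .refl⟩
    | @tail b c _ h ih =>
      rcases ih with ih | ⟨hb, ih⟩
      · exact .inl ih
      · by_cases hc : c ∈ X
        · exact .inr ⟨hc, ih.tail ⟨h, hc⟩⟩
        · exact .inl ⟨c, hc, b, ih, h⟩
  rcases key y h with h | h
  · exact h
  · exact absurd h.1 hy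

theorem Via.swap (h : Via r X x y) : Via (Function.swap r) X y x := by
  obtain ⟨c, hc, h⟩ := h
  induction hc generalizing y with
  | refl => exact Via.single h
  | tail _ hbc ih => exact Via.cons h hbc.2 (ih hbc.1)

end Walks

/-! ### Orientable paths and their lengths in bipartite graphs -/

namespace MixedGraph

variable {V : Type*}

/-- Build the path from its end; when the new first vertex already occurs, cut out the closed part.
-/
theorem exists_isOrientablePath_of_reachIn {G : MixedGraph V} {X : Set V} {x y : V}
    (h : ReachIn G.Step X x y) : ∃ l, G.IsOrientablePath x y l ∧ ∀ a ∈ l, a ∈ X := by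
  obtain ⟨hx, h⟩ := h
  revert hx
  induction h using ReflTransGen.head_induction_on with
  | refl => exact fun hx => ⟨[y], ⟨rfl, rfl, by simp, by simp⟩, by simpa⟩
  | @head a b hab _ ih =>
    intro ha
    obtain ⟨l, ⟨h1, h2, h3, h4⟩, h5⟩ := ih hab.2
    by_cases hal : a ∈ l
    · obtain ⟨s, t, rfl⟩ := List.mem_iff_append.1 hal
      refine ⟨a :: t, ⟨rfl, ?_, ?_, ?_⟩, fun c hc => h5 c (by simp at hc ⊢; tauto)⟩
      · simpa [List.getLast?_append] using h2
      · exact (List.nodup_append.1 h3).2.1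
      · exact (List.isChain_append.1 h4).2.1
    · obtain ⟨t, rfl⟩ : ∃ t, l = b :: t := by
        cases l with
        | nil => simp at h1
        | cons c t => simp at h1; exact ⟨t, by rw [h1]⟩
      refine ⟨a :: b :: t, ⟨rfl, ?_, ?_, ?_⟩, ?_⟩
      · simpa using h2
      · exact List.nodup_cons.2 ⟨hal, h3⟩
      · exact List.isChain_cons_cons.2 ⟨hab.1, h4⟩
      · intro c hc
        rcases List.mem_cons.1 hc with rfl | hc
        · exact ha
        · exact h5 c hc

theorem reflTransGen_of_isOrientablePath {G : MixedGraph V} {x y : V} {l : List V}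
    (h : G.IsOrientablePath x y l) : ReflTransGen G.Step x y := by
  obtain ⟨h1, h2, -, h4⟩ := h
  induction l generalizing x with
  | nil => simp at h1
  | cons a t ih =>
    obtain rfl : a = x := by simpa using h1
    cases t with
    | nil => obtain rfl : a = y := by simpa using h2
             exact .refl
    | cons b t =>
      rw [List.isChain_cons_cons] at h4
      exact .head h4.1 (ih rfl (by simpa using h2) h4.2)

theorem isConnected_iff {G : MixedGraph V} :
    G.IsConnected ↔ ∀ x y, ReflTransGen G.Step x y := by
  constructor
  · intro h x y
    obtain ⟨l, hl⟩ := h x y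
    exact reflTransGen_of_isOrientablePath hl
  · intro h x y
    obtain ⟨l, hl, -⟩ := exists_isOrientablePath_of_reachIn (G := G) (X := Set.univ) (x := x) (y := y)
      ⟨trivial, ReflTransGen.mono (fun _ _ h => ⟨h, trivial⟩) _ _ (h x y)⟩
    exact ⟨l, hl⟩

-- Vertices alternate between `A` and its complement, so twice the number of vertices in `A` differs
-- from the length of the list only by what happens at the two ends.
open Classical in
theorem length_add_eq_of_isChain {r : V → V → Prop} {A : Set V}
    (hr : ∀ a b, r a b → (a ∈ A ↔ b ∉ A)) {l : List V} {x y : V} (h1 : l.head? = some x)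
    (h2 : l.getLast? = some y) (h3 : l.IsChain r) :
    l.length + (if x ∈ A then 1 else 0) + (if y ∈ A then 1 else 0) =
      2 * (l.filter (· ∈ A)).length + 1 := by
  induction l generalizing x with
  | nil => simp at h1
  | cons a t ih =>
    obtain rfl : a = x := by simpa using h1
    cases t with
    | nil => obtain rfl : a = y := by simpa using h2
             by_cases ha : a ∈ A <;> simp [ha]
    | cons b t =>
      rw [List.isChain_cons_cons] at h3
      have h := ih (x := b) rfl (by simpa using h2) h3.2
      have := hr a b h3.1
      by_cases ha : a ∈ A
      · have hb : b ∉ A := this.1 ha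
        rw [List.filter_cons_of_pos (by simpa using ha)]
        simp only [ha, hb, List.length_cons, if_true, if_false] at h ⊢
        omega
      · have hb : b ∈ A := by tauto
        rw [List.filter_cons_of_neg (by simpa using ha)]
        simp only [ha, hb, List.length_cons, if_true, if_false] at h ⊢
        omega

open Classical in
/-- In a bipartite graph with part `A`, a walk inside `X` bounds the distance in terms of the number
of vertices of `A` in `X`. -/
theorem dist_add_le_of_reachIn [Finite V] {G : MixedGraph V} {A X : Set V}
    (hG : ∀ a b, G.Step a b → (a ∈ A ↔ b ∉ A)) {x y : V} (h : ReachIn G.Step X x y) :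
    G.dist x y + ((if x ∈ A then 1 else 0) + (if y ∈ A then 1 else 0) : ℕ) ≤
      (2 * (A ∩ X).ncard : ℕ) := by
  obtain ⟨l, hl, hX⟩ := exists_isOrientablePath_of_reachIn h
  have hlen := length_add_eq_of_isChain hG hl.1 hl.2.1 hl.2.2.2
  have hne : l ≠ [] := by
    rintro rfl
    simpa using hl.1
  have hcard : (l.filter (· ∈ A)).length ≤ (A ∩ X).ncard := by
    rw [← List.toFinset_card_of_nodup (hl.2.2.1.filter _), ← Set.ncard_coe_finset]
    refine Set.ncard_le_ncard ?_ (Set.toFinite _)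
    intro a ha
    simp at ha
    exact ⟨ha.2, hX a ha.1⟩
  have hdist : G.dist x y ≤ ((l.length - 1 : ℕ) : ℕ∞) :=
    iInf₂_le (l.length - 1) ⟨l, hl, by have := List.length_pos_of_ne_nil hne; omega⟩
  refine (add_le_add_left hdist _).trans ?_
  have := List.length_pos_of_ne_nil hne
  exact_mod_cast (by omega)

end MixedGraph

/-! ### Strong orientations of bridgeless mixed graphs -/

namespace MixedGraph

variable {V : Type*}

/-- The mixed graph obtained by directing the undirected edge `xy` from `x` to `y`. -/
def directEdge (G : MixedGraph V) {x y : V} (h : G.edge.Adj x y) : MixedGraph V where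
  edge := G.edge.deleteEdges {s(x, y)}
  arc a b := G.arc a b ∨ (a = x ∧ b = y)
  arc_irrefl := by
    rintro a (ha | ⟨rfl, rfl⟩)
    · exact G.arc_irrefl a ha
    · exact G.edge.irrefl h
  arc_asymm := by
    rintro a b (ha | ⟨rfl, rfl⟩) (hb | ⟨h1, h2⟩)
    · exact G.arc_asymm a b ha hb
    · subst h1 h2; exact G.not_edge_of_arc _ _ ha h.symm
    · exact G.not_edge_of_arc _ _ hb h.symm
    · subst h1; exact G.edge.irrefl h
  not_edge_of_arc := by
    rintro a b (ha | ⟨rfl, rfl⟩) hab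
    · exact G.not_edge_of_arc a b ha (SimpleGraph.deleteEdges_le _ hab)
    · simp at hab

theorem IsOrientation.trans {D H G : MixedGraph V} (hD : D.IsOrientation H)
    (h1 : ∀ x y, G.arc x y → H.arc x y)
    (h2 : ∀ x y, G.edge.Adj x y → H.edge.Adj x y ∨ H.arc x y ∨ H.arc y x)
    (h3 : ∀ x y, H.arc x y → G.arc x y ∨ G.edge.Adj x y)
    (h4 : H.edge ≤ G.edge) : D.IsOrientation G where
  isDirected := hD.isDirected
  arc_of_arc x y h := hD.arc_of_arc x y (h1 x y h)
  arc_of_edge x y h := by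
    rcases h2 x y h with h | h | h
    · exact hD.arc_of_edge x y h
    · exact .inl (hD.arc_of_arc _ _ h)
    · exact .inr (hD.arc_of_arc _ _ h)
  of_arc x y h := by
    rcases hD.of_arc x y h with h | h
    · exact h3 x y h
    · exact .inr (h4 h)

/-- Directing some edges of a bridgeless mixed graph creates no bridge. -/
theorem IsBridgeless.of_partial_orientation {H G : MixedGraph V} (hG : G.IsBridgeless)
    (hH : H.IsConnected) (h1 : ∀ x y, G.arc x y → H.arc x y)
    (h2 : ∀ x y, G.edge.Adj x y → H.edge.Adj x y ∨ H.arc x y ∨ H.arc y x)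
    (h4 : H.edge ≤ G.edge) : H.IsBridgeless := by
  refine ⟨hH, fun e ⟨he, hconn⟩ => hG.2 e ⟨SimpleGraph.edgeSet_mono h4 he, fun hc => hconn ?_⟩⟩
  refine hc.mono ?_
  rintro a b (hab | hab | hab)
  · have hab' : G.edge.Adj a b ∧ s(a, b) ≠ e := by simpa [deleteEdge] using hab
    rcases h2 a b hab'.1 with h | h | h
    · exact .inl (by simpa [deleteEdge] using ⟨h, hab'.2⟩)
    · exact .inr (.inl h)
    · exact .inr (.inr h)
  · exact .inr (.inl (h1 _ _ hab))
  · exact .inr (.inr (h1 _ _ hab))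

/-- If neither end reached the other without the edge, the sets reachable from `x` and from `y`
would cover all vertices. They would be disjoint, since every vertex still reaches `x` or `y`. No
remaining edge, in either direction, would join them, so the edge would be a bridge. -/
theorem reflTransGen_or_of_not_isBridge {G : MixedGraph V} (hG : ∀ x y, ReflTransGen G.Step x y)
    {x y : V} (hxy : G.edge.Adj x y) (hb : ¬ G.IsBridge s(x, y)) :
    ReflTransGen (G.deleteEdge s(x, y)).Step x y ∨ ReflTransGen (G.deleteEdge s(x, y)).Step y x := by
  by_contra! hcon
  obtain ⟨hx, hy⟩ := hcon
  set R := (G.deleteEdge s(x, y)).Step with hR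
  have hstep : ∀ a b, G.Step a b → R a b ∨ (a = x ∧ b = y) ∨ (a = y ∧ b = x) := by
    rintro a b (h | h)
    · by_cases he : s(a, b) = s(x, y)
      · right; simpa using he
      · exact .inl (.inl (by simpa [deleteEdge] using ⟨h, by simpa using he⟩))
    · exact .inl (.inr h)
  have hfrom : ∀ z, ReflTransGen R x z ∨ ReflTransGen R y z := by
    intro z
    induction hG x z with
    | refl => exact .inl .refl
    | tail _ h ih =>
      rcases hstep _ _ h with h | ⟨rfl, rfl⟩ | ⟨rfl, rfl⟩
      · exact ih.imp (·.tail h) (·.tail h)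
      · exact .inr .refl
      · exact .inl .refl
  have hto : ∀ z, ReflTransGen R z x ∨ ReflTransGen R z y := by
    intro z
    induction hG z x using ReflTransGen.head_induction_on with
    | refl => exact .inl .refl
    | head h _ ih =>
      rcases hstep _ _ h with h | ⟨rfl, rfl⟩ | ⟨rfl, rfl⟩
      · exact ih.imp (·.head h) (·.head h)
      · exact .inl .refl
      · exact .inr .refl
  have hdisj : ∀ z, ReflTransGen R x z → ¬ ReflTransGen R y z := by
    intro z hz hz'
    rcases hto z with h | h
    · exact hy (hz'.trans h)
    · exact hx (hz.trans h)
  refine hb ⟨hxy, fun hc => ?_⟩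
  have hreach : ∀ z, (G.deleteEdge s(x, y)).underlying.Reachable x z → ReflTransGen R x z := by
    intro z hz
    rw [SimpleGraph.reachable_iff_reflTransGen] at hz
    induction hz with
    | refl => exact .refl
    | @tail a b _ h ih =>
      rcases h with h | h | h
      · exact ih.tail (.inl h)
      · exact ih.tail (.inr h)
      · by_contra hbx
        have hby := (hfrom b).resolve_left hbx
        exact hdisj a ih (hby.tail (.inr h))
  exact hx (hreach y (hc.preconnected x y))

/-- The only step that is lost is the one from `y` to `x`, and the assumed walk replaces it. -/
theorem isConnected_directEdge {G : MixedGraph V} (hG : ∀ x y, ReflTransGen G.Step x y)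
    {x y : V} (hxy : G.edge.Adj x y) (h : ReflTransGen (G.deleteEdge s(x, y)).Step y x) :
    (G.directEdge hxy).IsConnected := by
  rw [isConnected_iff]
  have hle : ∀ a b, (G.deleteEdge s(x, y)).Step a b → (G.directEdge hxy).Step a b := by
    rintro a b (h | h)
    · exact .inl h
    · exact .inr (.inl h)
  intro a b
  induction hG a b with
  | refl => exact .refl
  | @tail b c _ hbc ih =>
    refine ih.trans ?_
    rcases hbc with hbc | hbc
    · by_cases he : s(b, c) = s(x, y)
      · rcases (by simpa using he : (b = x ∧ c = y) ∨ (b = y ∧ c = x)) with ⟨rfl, rfl⟩ | ⟨rfl, rfl⟩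
        · exact .single (.inr (.inr ⟨rfl, rfl⟩))
        · exact ReflTransGen.mono hle _ _ h
      · exact .single (.inl (by simpa [directEdge] using ⟨hbc, by simpa using he⟩))
    · exact .single (.inr (.inl hbc))

/-- The theorem of Boesch and Tindell: a bridgeless mixed graph has a strong orientation. -/
theorem IsBridgeless.exists_isStrongOrientation [Finite V] {G : MixedGraph V}
    (hG : G.IsBridgeless) : ∃ D : MixedGraph V, D.IsStrongOrientation G := by
  induction hn : G.edge.edgeSet.ncard using Nat.strong_induction_on generalizing G with
  | _ n ih =>
    by_cases hd : ∃ x y, G.edge.Adj x y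
    · obtain ⟨x, y, hxy⟩ := hd
      have hconn := isConnected_iff.1 hG.1
      -- One of the ends reaches the other without the edge, so one of the two directions keeps the
      -- graph connected.
      wlog hr : ReflTransGen (G.deleteEdge s(x, y)).Step y x generalizing x y
      · refine this y x hxy.symm ?_
        rw [Sym2.eq_swap]
        exact (reflTransGen_or_of_not_isBridge hconn hxy (hG.2 _)).resolve_right hr
      have h1 : ∀ a b, G.arc a b → (G.directEdge hxy).arc a b := fun a b h => .inl h
      have h2 : ∀ a b, G.edge.Adj a b → (G.directEdge hxy).edge.Adj a b ∨
          (G.directEdge hxy).arc a b ∨ (G.directEdge hxy).arc b a := by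
        intro a b hab
        by_cases he : s(a, b) = s(x, y)
        · rcases (by simpa using he : (a = x ∧ b = y) ∨ (a = y ∧ b = x)) with h | h
          · exact .inr (.inl (.inr h))
          · exact .inr (.inr (.inr h.symm))
        · exact .inl (by simpa [directEdge] using ⟨hab, by simpa using he⟩)
      have h3 : ∀ a b, (G.directEdge hxy).arc a b → G.arc a b ∨ G.edge.Adj a b := by
        rintro a b (h | ⟨rfl, rfl⟩)
        · exact .inl h
        · exact .inr hxy
      have h4 : (G.directEdge hxy).edge ≤ G.edge := SimpleGraph.deleteEdges_le _
      have hlt : (G.directEdge hxy).edge.edgeSet.ncard < n := by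
        rw [← hn]
        refine Set.ncard_lt_ncard ⟨SimpleGraph.edgeSet_mono h4, fun h => ?_⟩ (Set.toFinite _)
        have : s(x, y) ∈ (G.directEdge hxy).edge.edgeSet := h hxy
        simp [directEdge] at this
      obtain ⟨D, hD, hDc⟩ := ih _ hlt
        (hG.of_partial_orientation (isConnected_directEdge hconn hxy hr) h1 h2 h4) rfl
      exact ⟨D, hD.trans h1 h2 h3 h4, hDc⟩
    · push Not at hd
      exact ⟨G, ⟨hd, fun _ _ h => h, fun _ _ h => absurd h (hd _ _), fun _ _ h => .inl h⟩, hG.1⟩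

end MixedGraph

/-! ### Choosing the directions of the edges at a vertex -/

/-- A strongly connected relation `r` around a vertex `u`: all neighbours of `u` lie in the set `N`
(whose arcs at `u` may be redirected), in the set `P` of heads of fixed arcs or in the set `M` of
tails of fixed arcs. -/
structure Hub {V : Type*} (r : V → V → Prop) (u : V) (N P M : Set V) : Prop where
  strong : ∀ x y, ReflTransGen r x y
  out_mem : ∀ v, r u v → v ∈ N ∨ v ∈ P
  in_mem : ∀ v, r v u → v ∈ N ∨ v ∈ M
  asymm : ∀ v, r u v → ¬ r v u
  arc_or : ∀ v ∈ N, r u v ∨ r v u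
  left_arc : ∀ v ∈ P, r u v
  right_arc : ∀ v ∈ M, r v u
  left_disj : ∀ v ∈ P, v ∉ N
  right_disj : ∀ v ∈ M, v ∉ N

namespace Hub

variable {V : Type*} {r : V → V → Prop} {u : V} {N P M Q : Set V}

/-- The vertices different from `u` and outside `N`. -/
def free (u : V) (N : Set V) : Set V := {w | w ∉ N ∧ w ≠ u}

theorem swap (h : Hub r u N P M) : Hub (Function.swap r) u N M P where
  strong x y := reflTransGen_swap.2 (h.strong y x)
  out_mem := h.in_mem
  in_mem := h.out_mem
  asymm v h1 h2 := h.asymm v h2 h1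
  arc_or v hv := (h.arc_or v hv).symm
  left_arc := h.right_arc
  right_arc := h.left_arc
  left_disj := h.right_disj
  right_disj := h.left_disj

theorem not_self (h : Hub r u N P M) : ¬ r u u := fun hu => h.asymm u hu hu

theorem ne_of_mem (h : Hub r u N P M) {v : V} (hv : v ∈ N) : v ≠ u := by
  rintro rfl
  rcases h.arc_or v hv with h' | h' <;> exact h.not_self h'

theorem left_mem_free (h : Hub r u N P M) {v : V} (hv : v ∈ P) : v ∈ free u N :=
  ⟨h.left_disj v hv, by rintro rfl; exact h.not_self (h.left_arc v hv)⟩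

theorem right_mem_free (h : Hub r u N P M) {v : V} (hv : v ∈ M) : v ∈ free u N :=
  h.swap.left_mem_free hv

/-- A vertex with an arc into `u` is entered from elsewhere. -/
theorem exists_via_of_arc (h : Hub r u N P M) {v : V} (hv : v ∈ N) (hvu : r v u) :
    (∃ s ∈ P, Via r (free u N) s v) ∨ ∃ a ∈ N, a ≠ v ∧ Via r (free u N) a v := by
  obtain ⟨z, hz, c, hc, hcz⟩ := exists_first_visit (X := {v}ᶜ) (h.strong u v)
    (by simpa using (h.ne_of_mem hv).symm) (by simp)
  obtain rfl : z = v := by simpa using hz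
  -- Record the last vertex of `N ∪ {u}` on the walk. If it is `u`, the walk has left `u` through a
  -- fixed arc.
  have key : c = u ∨ (∃ a ∈ N, a ≠ z ∧ (c = a ∨ (c ∈ free u N ∧ Via r (free u N) a c))) ∨
      ∃ s ∈ P, c = s ∨ (c ∈ free u N ∧ Via r (free u N) s c) := by
    clear hcz
    induction hc with
    | refl => exact .inl rfl
    | @tail b c _ hbc ih =>
      by_cases hcN : c ∈ N
      · exact .inr (.inl ⟨c, hcN, hbc.2, .inl rfl⟩)
      by_cases hcu : c = u
      · exact .inl hcu
      have hcF : c ∈ free u N := ⟨hcN, hcu⟩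
      rcases ih with rfl | ⟨a, ha, haz, rfl | ⟨hb, hab⟩⟩ | ⟨s, hs, rfl | ⟨hb, hsb⟩⟩
      · exact .inr (.inr ⟨c, (h.out_mem c hbc.1).resolve_left hcN, .inl rfl⟩)
      · exact .inr (.inl ⟨b, ha, haz, .inr ⟨hcF, .single hbc.1⟩⟩)
      · exact .inr (.inl ⟨a, ha, haz, .inr ⟨hcF, hab.snoc hb hbc.1⟩⟩)
      · exact .inr (.inr ⟨b, hs, .inr ⟨hcF, .single hbc.1⟩⟩)
      · exact .inr (.inr ⟨s, hs, .inr ⟨hcF, hsb.snoc hb hbc.1⟩⟩)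
  rcases key with rfl | ⟨a, ha, haz, rfl | ⟨hb, hab⟩⟩ | ⟨s, hs, rfl | ⟨hb, hsb⟩⟩
  · exact absurd hvu (h.asymm _ hcz)
  · exact .inr ⟨c, ha, haz, .single hcz⟩
  · exact .inr ⟨a, ha, haz, hab.snoc hb hcz⟩
  · exact .inl ⟨c, hs, .single hcz⟩
  · exact .inl ⟨s, hs, hsb.snoc hb hcz⟩

theorem exists_via_of_arc' (h : Hub r u N P M) {v : V} (hv : v ∈ N) (huv : r u v) :
    (∃ w ∈ M, Via r (free u N) v w) ∨ ∃ a ∈ N, a ≠ v ∧ Via r (free u N) v a := by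
  rcases h.swap.exists_via_of_arc hv huv with ⟨s, hs, h'⟩ | ⟨a, ha, hav, h'⟩
  · exact .inl ⟨s, hs, h'.swap⟩
  · exact .inr ⟨a, ha, hav, h'.swap⟩

/-- `v` can be entered from `u` through a fixed arc, without visiting `N` before. -/
def Source (r : V → V → Prop) (u : V) (N P : Set V) (v : V) : Prop :=
  ∃ s ∈ P, Via r (free u N) s v

/-- One can go from `v` to `u` through a fixed arc, without visiting `N` again. -/
def Sink (r : V → V → Prop) (u : V) (N M : Set V) (v : V) : Prop :=
  ∃ w ∈ M, Via r (free u N) v w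

/-- A walk from a fixed arc through `a` to `q` that misses another fixed arc. -/
def Detour (r : V → V → Prop) (u : V) (N P M : Set V) (a q : V) : Prop :=
  ∃ s ∈ P, ∃ m ∈ P ∪ M, m ≠ s ∧ Via r (free u N \ {m}) s a ∧ Via r (free u N \ {m}) a q

/-- The condition for a vertex `q ∈ Q`, where the vertices of `Q` are those with an arc into `u`. -/
def Good (r : V → V → Prop) (u : V) (N P M Q : Set V) (q : V) : Prop :=
  Source r u N P q ∨ (¬ Sink r u N M q ∧
    ((∃ a ∈ N, a ∉ Q ∧ Via r (free u N) a q) ∨ ∃ a ∈ N, Detour r u N P M a q))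

/-- A set of vertices to be directed into `u` such that no further vertex can be added. -/
structure IsSplit (r : V → V → Prop) (u : V) (N P M Q : Set V) : Prop where
  subset : Q ⊆ N
  good : ∀ q ∈ Q, Good r u N P M Q q
  mem : ∀ v ∈ N, ¬ Sink r u N M v → (∀ z ∈ N, z ≠ v → ¬ Via r (free u N) v z) → v ∈ Q
  maximal : ∀ v ∈ N, v ∉ Q → ∃ q ∈ insert v Q, ¬ Good r u N P M (insert v Q) q

/-- `Q₀` consists of the vertices that can leave only along their arc into `u`. In `r` these arcs do
point into `u`, so by `exists_via_of_arc` such a vertex is entered from a fixed arc or from another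
vertex of `N`; the latter has a way out and thus is not in `Q₀`. Hence all of `Q₀` is good, and a
maximal good set above it is taken. -/
theorem exists_isSplit [Finite V] (h : Hub r u N P M) : ∃ Q, IsSplit r u N P M Q := by
  let Q₀ : Set V := {v | v ∈ N ∧ ¬ Sink r u N M v ∧ ∀ z ∈ N, z ≠ v → ¬ Via r (free u N) v z}
  have h₀ : Q₀ ⊆ N ∧ ∀ q ∈ Q₀, Good r u N P M Q₀ q := by
    refine ⟨fun v hv => hv.1, fun q ⟨hq, hT, hz⟩ => ?_⟩
    have hqu : r q u := by
      refine (h.arc_or q hq).resolve_left fun huq => ?_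
      rcases h.exists_via_of_arc' hq huq with h' | ⟨a, ha, hne, h'⟩
      · exact hT h'
      · exact hz a ha hne h'
    rcases h.exists_via_of_arc hq hqu with h' | ⟨a, ha, hne, h'⟩
    · exact .inl h'
    · exact .inr ⟨hT, .inl ⟨a, ha, fun ha' => ha'.2.2 q hq hne.symm h', h'⟩⟩
  obtain ⟨Q, hQ₀, hQ, hmax⟩ := Finite.exists_le_maximal
    (p := fun Q : Set V => Q ⊆ N ∧ ∀ q ∈ Q, Good r u N P M Q q) h₀
  refine ⟨Q, hQ.1, hQ.2, fun v hv hT hz => hQ₀ ⟨hv, hT, hz⟩, fun v hv hvQ => ?_⟩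
  by_contra! hcon
  exact hvQ (hmax ⟨Set.insert_subset hv hQ.1, hcon⟩ (Set.subset_insert v Q) (Set.mem_insert v Q))

/-- By `hin`, `v` would itself be good after being added. So the vertex spoiled by adding `v` is an
old `q ∈ Q`, which happens only if `v` was its one supplier outside `Q` and `q` has no detour. -/
theorem IsSplit.exists_via (hQ : IsSplit r u N P M Q) {v : V} (hv : v ∈ N) (hvQ : v ∉ Q)
    (hT : ¬ Sink r u N M v)
    (hin : Source r u N P v ∨ (∃ a ∈ N, a ∉ Q ∧ a ≠ v ∧ Via r (free u N) a v) ∨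
      ∃ a ∈ N, Detour r u N P M a v) :
    ∃ q ∈ Q, ¬ Source r u N P q ∧ ¬ Sink r u N M q ∧ Via r (free u N) v q ∧
      ¬ Detour r u N P M v q := by
  obtain ⟨q, hq, hbad⟩ := hQ.maximal v hv hvQ
  rcases Set.mem_insert_iff.1 hq with rfl | hq
  · refine absurd ?_ hbad
    rcases hin with h | ⟨a, ha, haQ, hne, h⟩ | h
    · exact .inl h
    · exact .inr ⟨hT, .inl ⟨a, ha, by simp [hne, haQ], h⟩⟩
    · exact .inr ⟨hT, .inr h⟩
  · unfold Good at hbad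
    rw [not_or, not_and, not_or] at hbad
    obtain ⟨hS, hbad⟩ := hbad
    rcases hQ.good q hq with h | ⟨hTq, h⟩
    · exact absurd h hS
    · obtain ⟨h1, h2⟩ := hbad hTq
      refine ⟨q, hq, hS, hTq, ?_, fun hd => h2 ⟨v, hv, hd⟩⟩
      rcases h with ⟨a, ha, haQ, hav⟩ | h
      · by_cases hne : a = v
        · exact hne ▸ hav
        · exact absurd ⟨a, ha, by simp [hne, haQ], hav⟩ h1
      · exact absurd h h2

/-- From a vertex of `N` one can reach `u` by visiting at most two vertices of `N`, or three and no
end of a fixed arc. -/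
theorem IsSplit.prefix_cases (h : Hub r u N P M) (hQ : IsSplit r u N P M Q) {v : V} (hv : v ∈ N) :
    v ∈ Q ∨ Sink r u N M v ∨ (∃ q ∈ Q, Via r (free u N) v q) ∨
    (∃ z ∈ N, Sink r u N M z ∧ Via r (free u N) v z) ∨
    (¬ Source r u N P v ∧ ∃ z ∈ N, ∃ q ∈ Q, Via r (free u N) v z ∧ Via r (free u N) z q ∧
      ((P ∪ M).Nontrivial → ∀ m ∈ P ∪ M,
        Via r (free u N \ {m}) v z ∧ Via r (free u N \ {m}) z q)) := by
  by_cases hvQ : v ∈ Q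
  · exact .inl hvQ
  by_cases hT : Sink r u N M v
  · exact .inr (.inl hT)
  refine .inr (.inr ?_)
  by_cases hin : Source r u N P v ∨ (∃ a ∈ N, a ∉ Q ∧ a ≠ v ∧ Via r (free u N) a v) ∨
      ∃ a ∈ N, Detour r u N P M a v
  · obtain ⟨q, hq, -, -, hvq, -⟩ := hQ.exists_via hv hvQ hT hin
    exact .inl ⟨q, hq, hvq⟩
  rw [not_or] at hin
  obtain ⟨z, hz, hne, hvz⟩ : ∃ z ∈ N, z ≠ v ∧ Via r (free u N) v z := by
    by_contra! hcon
    exact hvQ (hQ.mem v hv hT hcon)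
  by_cases hzQ : z ∈ Q
  · exact .inl ⟨z, hzQ, hvz⟩
  refine .inr ?_
  by_cases hTz : Sink r u N M z
  · exact .inl ⟨z, hz, hTz, hvz⟩
  refine .inr ⟨hin.1, z, hz, ?_⟩
  -- The vertex `v` lies outside `Q` and supplies `z`, so `z` leads straight to `Q`.
  obtain ⟨q, hq, hSq, hTq, hzq, hd⟩ := hQ.exists_via hz hzQ hTz
    (.inr (.inl ⟨v, hv, hvQ, hne.symm, hvz⟩))
  refine ⟨q, hq, hvz, hzq, fun hnt m hm => ?_⟩
  have hzq' : ∀ m ∈ P ∪ M, Via r (free u N \ {m}) z q := by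
    intro m hm
    refine (hzq.split_last m).resolve_right fun ⟨h1, h2⟩ => ?_
    rcases hm with hm | hm
    · exact hSq ⟨m, hm, h2.mono Set.sdiff_subset⟩
    · exact hTz ⟨m, hm, h1⟩
  -- If the walk from `v` to `z` had to pass `m`, then `m` would be the head of a fixed arc, as `v`
  -- is no sink. With a second end `m'`, a walk from one of `m`, `m'` to `z` missing the other would
  -- complete to a detour through `z` to `q`.
  refine ⟨(hvz.split_last m).resolve_right fun ⟨h1, h2⟩ => hd ?_, hzq' m hm⟩
  have hmP : m ∈ P := hm.resolve_right fun hmM => hT ⟨m, hmM, h1⟩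
  obtain ⟨m', hm', hmm'⟩ := hnt.exists_ne m
  rcases h2.split_last m' with h3 | ⟨h3, h4⟩
  · exact ⟨m, hmP, m', hm', hmm',
      h3.mono fun x hx => ⟨hx.1.1, hx.2⟩, hzq' m' hm'⟩
  · have hm'P : m' ∈ P := hm'.resolve_right fun hmM =>
      hT ⟨m', hmM, h1.trans (h.left_mem_free hmP) (h3.mono Set.sdiff_subset)⟩
    exact ⟨m', hm'P, m, hm, hmm'.symm, h4.mono Set.sdiff_subset, hzq' m hm⟩

/-- The relation `r` with the arcs between `u` and `N` redirected: into `u` from `Q`, out of `u` to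
the rest of `N`. -/
def redirect (r : V → V → Prop) (u : V) (N P M Q : Set V) (a b : V) : Prop :=
  (a ≠ u ∧ b ≠ u ∧ r a b) ∨ (a = u ∧ (b ∈ P ∨ (b ∈ N ∧ b ∉ Q))) ∨ (b = u ∧ (a ∈ M ∨ a ∈ Q))

theorem reachIn_redirect {Y W : Set V} {a b : V} (h : Via r Y a b) (hY : Y ⊆ free u N)
    (ha : a ≠ u) (hb : b ≠ u) (hYW : Y ⊆ W) (haW : a ∈ W) (hbW : b ∈ W) :
    ReachIn (redirect r u N P M Q) W a b := by
  refine ((h.congr_rel ?_).mono hYW).reachIn haW hbW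
  rintro c d hc hd hcd
  refine .inl ⟨?_, ?_, hcd⟩
  · rcases hc with rfl | hc
    · exact ha
    · exact (hY hc).2
  · rcases hd with rfl | hd
    · exact hb
    · exact (hY hd).2

theorem redirect_in {a : V} {W : Set V} (ha : a ∈ M ∨ a ∈ Q) (hW : a ∈ W)
    (hu : u ∈ W) : ReachIn (redirect r u N P M Q) W a u :=
  .single hW hu (.inr (.inr ⟨rfl, ha⟩))

theorem redirect_out {a : V} {W : Set V} (ha : a ∈ P ∨ (a ∈ N ∧ a ∉ Q))
    (hW : a ∈ W) (hu : u ∈ W) : ReachIn (redirect r u N P M Q) W u a :=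
  .single hu hW (.inr (.inl ⟨rfl, ha⟩))

end Hub

/-! ### Walks to and from the centre after redirecting -/

namespace Hub

variable {V : Type*} {r : V → V → Prop} {u : V} {N P M Q : Set V}

theorem ncard_pair_le (a b : V) : ({a, b} : Set V).ncard ≤ 2 :=
  (Set.ncard_insert_le _ _).trans (by simp)

theorem ncard_triple_le (a b c : V) : ({a, b, c} : Set V).ncard ≤ 3 :=
  (Set.ncard_insert_le _ _).trans (by have := ncard_pair_le b c; omega)

theorem exists_first_mem (h : Hub r u N P M) {x : V} (hx : x ∈ free u N) :
    (x ∈ M ∨ ∃ w ∈ M, Via r (free u N) x w) ∨ ∃ v ∈ N, Via r (free u N) x v := by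
  obtain ⟨z, hz, hxz⟩ := exists_first_visit (h.strong x u) hx (fun hu => hu.2 rfl)
  by_cases hzN : z ∈ N
  · exact .inr ⟨z, hzN, hxz⟩
  · have hzu : z = u := by
      by_contra hzu
      exact hz ⟨hzN, hzu⟩
    obtain ⟨c, hc, hcu⟩ := hxz
    rw [hzu] at hcu
    rcases ReflTransGen.cases_tail hc with rfl | ⟨b, hb, hbc⟩
    · exact .inl (.inl ((h.in_mem c hcu).resolve_left hx.1))
    · exact .inl (.inr ⟨c, (h.in_mem c hcu).resolve_left hbc.2.1, b, hb, hbc.1⟩)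

theorem exists_last_mem (h : Hub r u N P M) {y : V} (hy : y ∈ free u N) :
    (y ∈ P ∨ ∃ s ∈ P, Via r (free u N) s y) ∨ ∃ v ∈ N, Via r (free u N) v y := by
  rcases h.swap.exists_first_mem hy with (hy | ⟨s, hs, h'⟩) | ⟨v, hv, h'⟩
  · exact .inl (.inl hy)
  · exact .inl (.inr ⟨s, hs, h'.swap⟩)
  · exact .inr ⟨v, hv, h'.swap⟩

theorem reachIn_of_exit (h : Hub r u N P M) {x : V} (hx : x ≠ u) {W : Set V} (hW : free u N ⊆ W)
    (hxW : x ∈ W) (huW : u ∈ W) (hxM : x ∈ M ∨ ∃ w ∈ M, Via r (free u N) x w) :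
    ReachIn (redirect r u N P M Q) W x u := by
  rcases hxM with hxM | ⟨w, hw, hv⟩
  · exact redirect_in (.inl hxM) hxW huW
  · have hwF := h.right_mem_free hw
    exact (reachIn_redirect hv subset_rfl hx hwF.2 hW hxW (hW hwF)).trans
      (redirect_in (.inl hw) (hW hwF) huW)

theorem reachIn_of_enter (h : Hub r u N P M) {y : V} (hy : y ≠ u) {W : Set V} (hW : free u N ⊆ W)
    (hyW : y ∈ W) (huW : u ∈ W) (hyP : y ∈ P ∨ ∃ s ∈ P, Via r (free u N) s y) :
    ReachIn (redirect r u N P M Q) W u y := by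
  rcases hyP with hyP | ⟨s, hs, hv⟩
  · exact redirect_out (.inl hyP) hyW huW
  · have hsF := h.left_mem_free hs
    exact (redirect_out (.inl hs) (hW hsF) huW).trans
      (reachIn_redirect hv subset_rfl hsF.2 hy hW (hW hsF) hyW)

/-- Walk to the first vertex of `N`, unless a fixed arc into `u` is available earlier, and continue
by `IsSplit.prefix_cases`. The first piece misses all ends of fixed arcs: an end in `M` would be an
exit, and an end in `P` would make the first vertex of `N` a source, which is excluded in the case
of three vertices. -/
theorem IsSplit.exists_reachIn_hub (h : Hub r u N P M) (hQ : IsSplit r u N P M Q) (x : V) :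
    (∃ s ⊆ N, s.ncard ≤ 2 ∧ ReachIn (redirect r u N P M Q) (free u N ∪ insert u s) x u) ∨
    ∃ s ⊆ N, s.ncard ≤ 3 ∧ ReachIn (redirect r u N P M Q) (free u N ∪ insert u s) x u ∧
      ((P ∪ M).Nontrivial → ∀ m ∈ P ∪ M,
        ReachIn (redirect r u N P M Q) (free u N \ {m} ∪ insert u s) x u) := by
  by_cases hxu : x = u
  · exact .inl ⟨∅, by simp, by simp, .refl (by simp [hxu]) |> fun h => hxu ▸ h⟩
  by_cases hexit : x ∈ M ∨ ∃ w ∈ M, Via r (free u N) x w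
  · by_cases hxN : x ∈ N
    · exact .inl ⟨{x}, by simpa, by simp, h.reachIn_of_exit hxu Set.subset_union_left (by simp)
        (by simp) hexit⟩
    · exact .inl ⟨∅, by simp, by simp, h.reachIn_of_exit hxu Set.subset_union_left
        (.inl ⟨hxN, hxu⟩) (by simp) hexit⟩
  obtain ⟨v, hv, hxv, hxv'⟩ : ∃ v ∈ N,
      (∀ W, free u N ⊆ W → v ∈ W → ReachIn (redirect r u N P M Q) W x v) ∧
      (¬ Source r u N P v → ∀ m ∈ P ∪ M, ∀ W, free u N \ {m} ⊆ W → v ∈ W →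
        ReachIn (redirect r u N P M Q) W x v) := by
    by_cases hxN : x ∈ N
    · exact ⟨x, hxN, fun W _ h => .refl h, fun _ _ _ W _ h => .refl h⟩
    · have hxF : x ∈ free u N := ⟨hxN, hxu⟩
      obtain ⟨v, hv, hxv⟩ := (h.exists_first_mem hxF).resolve_left hexit
      refine ⟨v, hv, fun W hW hvW => reachIn_redirect hxv subset_rfl hxu (h.ne_of_mem hv) hW
        (hW hxF) hvW, fun hS m hm W hW hvW => ?_⟩
      have hxm : x ≠ m := by
        rintro rfl
        rcases hm with hm | hm
        · exact hS ⟨x, hm, hxv⟩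
        · exact hexit (.inl hm)
      refine reachIn_redirect ((hxv.split_last m).resolve_right fun ⟨h1, h2⟩ => ?_)
        Set.sdiff_subset hxu (h.ne_of_mem hv) hW (hW ⟨hxF, hxm⟩) hvW
      rcases hm with hm | hm
      · exact hS ⟨m, hm, h2.mono Set.sdiff_subset⟩
      · exact hexit (.inr ⟨m, hm, h1⟩)
  have hvu := h.ne_of_mem hv
  rcases hQ.prefix_cases h hv with hvQ | hT | ⟨q, hq, hvq⟩ | ⟨z, hz, hT, hvz⟩ |
    ⟨hS, z, hz, q, hq, hvz, hzq, hav⟩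
  · exact .inl ⟨{v}, by simpa, by simp, (hxv _ Set.subset_union_left (by simp)).trans
      (redirect_in (.inr hvQ) (by simp) (by simp))⟩
  · exact .inl ⟨{v}, by simpa, by simp, (hxv _ Set.subset_union_left (by simp)).trans
      (h.reachIn_of_exit hvu Set.subset_union_left (by simp) (by simp) (.inr hT))⟩
  · have hqN := hQ.subset hq
    exact .inl ⟨{v, q}, Set.insert_subset hv (by simpa), ncard_pair_le _ _,
      ((hxv _ Set.subset_union_left (by simp)).trans
      (reachIn_redirect hvq subset_rfl hvu (h.ne_of_mem hqN) Set.subset_union_left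
        (by simp) (by simp))).trans (redirect_in (.inr hq) (by simp) (by simp))⟩
  · exact .inl ⟨{v, z}, Set.insert_subset hv (by simpa), ncard_pair_le _ _,
      ((hxv _ Set.subset_union_left (by simp)).trans
      (reachIn_redirect hvz subset_rfl hvu (h.ne_of_mem hz) Set.subset_union_left
        (by simp) (by simp))).trans
      (h.reachIn_of_exit (h.ne_of_mem hz) Set.subset_union_left (by simp) (by simp) (.inr hT))⟩
  · have hqN := hQ.subset hq
    refine .inr ⟨{v, z, q}, Set.insert_subset hv (Set.insert_subset hz (by simpa)),
      ncard_triple_le _ _ _, ?_, fun hnt m hm => ?_⟩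
    · exact (((hxv _ Set.subset_union_left (by simp)).trans
        (reachIn_redirect hvz subset_rfl hvu (h.ne_of_mem hz) Set.subset_union_left
          (by simp) (by simp))).trans
        (reachIn_redirect hzq subset_rfl (h.ne_of_mem hz) (h.ne_of_mem hqN) Set.subset_union_left
          (by simp) (by simp))).trans (redirect_in (.inr hq) (by simp) (by simp))
    · obtain ⟨h1, h2⟩ := hav hnt m hm
      exact (((hxv' hS m hm _ Set.subset_union_left (by simp)).trans
        (reachIn_redirect h1 Set.sdiff_subset hvu (h.ne_of_mem hz) Set.subset_union_left
          (by simp) (by simp))).trans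
        (reachIn_redirect h2 Set.sdiff_subset (h.ne_of_mem hz) (h.ne_of_mem hqN)
          Set.subset_union_left (by simp) (by simp))).trans
        (redirect_in (.inr hq) (by simp) (by simp))

/-- Let `v` be the last vertex of `N` on a walk to `y`. One vertex of `N` suffices unless `v ∈ Q` is
not a source; then goodness of `v` supplies a predecessor `a`, entered directly from `u` or by a
detour. -/
theorem IsSplit.exists_hub_reachIn (h : Hub r u N P M) (hQ : IsSplit r u N P M Q) (y : V) :
    (∃ s ⊆ N, s.ncard ≤ 1 ∧ ReachIn (redirect r u N P M Q) (free u N ∪ insert u s) u y) ∨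
    ∃ s ⊆ N, s.ncard ≤ 2 ∧ ReachIn (redirect r u N P M Q) (free u N ∪ insert u s) u y ∧
      (P.Nonempty → ∃ m ∈ P ∪ M,
        ReachIn (redirect r u N P M Q) (free u N \ {m} ∪ insert u s) u y) := by
  by_cases hyu : y = u
  · exact .inl ⟨∅, by simp, by simp, .refl (by simp [hyu]) |> fun h => hyu ▸ h⟩
  by_cases henter : y ∈ P ∨ ∃ s ∈ P, Via r (free u N) s y
  · by_cases hyN : y ∈ N
    · exact .inl ⟨{y}, by simpa, by simp, h.reachIn_of_enter hyu Set.subset_union_left (by simp)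
        (by simp) henter⟩
    · exact .inl ⟨∅, by simp, by simp, h.reachIn_of_enter hyu Set.subset_union_left
        (.inl ⟨hyN, hyu⟩) (by simp) henter⟩
  obtain ⟨v, hv, hvy, hvy'⟩ : ∃ v ∈ N,
      (∀ W, free u N ⊆ W → v ∈ W → ReachIn (redirect r u N P M Q) W v y) ∧
      (¬ Sink r u N M v → ∀ m ∈ P ∪ M, ∀ W, free u N \ {m} ⊆ W → v ∈ W →
        ReachIn (redirect r u N P M Q) W v y) := by
    by_cases hyN : y ∈ N
    · exact ⟨y, hyN, fun W _ h => .refl h, fun _ _ _ W _ h => .refl h⟩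
    · have hyF : y ∈ free u N := ⟨hyN, hyu⟩
      obtain ⟨v, hv, hvy⟩ := (h.exists_last_mem hyF).resolve_left henter
      refine ⟨v, hv, fun W hW hvW => reachIn_redirect hvy subset_rfl (h.ne_of_mem hv) hyu hW
        hvW (hW hyF), fun hT m hm W hW hvW => ?_⟩
      have hym : y ≠ m := by
        rintro rfl
        rcases hm with hm | hm
        · exact henter (.inl hm)
        · exact hT ⟨y, hm, hvy⟩
      refine reachIn_redirect ((hvy.split_last m).resolve_right fun ⟨h1, h2⟩ => ?_)
        Set.sdiff_subset (h.ne_of_mem hv) hyu hW hvW (hW ⟨hyF, hym⟩)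
      rcases hm with hm | hm
      · exact henter (.inr ⟨m, hm, h2.mono Set.sdiff_subset⟩)
      · exact hT ⟨m, hm, h1⟩
  have hvu := h.ne_of_mem hv
  by_cases hvQ : v ∉ Q
  · exact .inl ⟨{v}, by simpa, by simp, (redirect_out (.inr ⟨hv, hvQ⟩) (by simp) (by simp)).trans
      (hvy _ Set.subset_union_left (by simp))⟩
  by_cases hS : Source r u N P v
  · exact .inl ⟨{v}, by simpa, by simp,
      (h.reachIn_of_enter hvu Set.subset_union_left (by simp) (by simp) (.inr hS)).trans
      (hvy _ Set.subset_union_left (by simp))⟩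
  obtain ⟨hT, ⟨a, ha, haQ, hav⟩ | ⟨a, ha, s, hs, m, hm, hms, hsa, hav⟩⟩ :=
    (hQ.good v (not_not.1 hvQ)).resolve_left hS
  · refine .inr ⟨{a, v}, Set.insert_subset ha (by simpa), ncard_pair_le _ _, ?_, ?_⟩
    · exact ((redirect_out (.inr ⟨ha, haQ⟩) (by simp) (by simp)).trans
        (reachIn_redirect hav subset_rfl (h.ne_of_mem ha) hvu Set.subset_union_left
          (by simp) (by simp))).trans (hvy _ Set.subset_union_left (by simp))
    · rintro ⟨m, hm⟩
      -- Any head `m` of a fixed arc will do: passing it on the way to `v` would make `v` a source.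
      refine ⟨m, .inl hm, ((redirect_out (.inr ⟨ha, haQ⟩) (by simp) (by simp)).trans
        (reachIn_redirect ((hav.split_last m).resolve_right fun ⟨h1, h2⟩ => hS ?_)
          Set.sdiff_subset (h.ne_of_mem ha) hvu Set.subset_union_left
          (by simp) (by simp))).trans (hvy' hT m (.inl hm) _ Set.subset_union_left (by simp))⟩
      exact ⟨m, hm, h2.mono Set.sdiff_subset⟩
  · have key : ReachIn (redirect r u N P M Q) (free u N \ {m} ∪ insert u {a, v}) u y := by
      have hsF := h.left_mem_free hs
      have hsW : s ∈ free u N \ {m} ∪ insert u {a, v} := .inl ⟨hsF, hms.symm⟩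
      exact (((redirect_out (.inl hs) hsW (by simp)).trans
        (reachIn_redirect hsa Set.sdiff_subset hsF.2 (h.ne_of_mem ha) Set.subset_union_left
          hsW (by simp))).trans
        (reachIn_redirect hav Set.sdiff_subset (h.ne_of_mem ha) hvu Set.subset_union_left
          (by simp) (by simp))).trans (hvy' hT m hm _ Set.subset_union_left (by simp))
    exact .inr ⟨{a, v}, Set.insert_subset ha (by simpa), ncard_pair_le _ _,
      key.mono (Set.union_subset_union_left _ Set.sdiff_subset), fun _ => ⟨m, hm, key⟩⟩

/-- After redirecting, any two vertices are joined by a walk with few vertices in `N`: at most five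
and, if there are at least two fixed arcs, at most four or at most five on a walk that misses an end
of a fixed arc. -/
def Balanced (r : V → V → Prop) (u : V) (N P M Q : Set V) : Prop :=
  ∀ x y, (∃ s ⊆ N, s.ncard ≤ 5 ∧ ReachIn (redirect r u N P M Q) (free u N ∪ insert u s) x y) ∧
    ((P ∪ M).Nontrivial →
      (∃ s ⊆ N, s.ncard ≤ 4 ∧ ReachIn (redirect r u N P M Q) (free u N ∪ insert u s) x y) ∨
      ∃ s ⊆ N, s.ncard ≤ 5 ∧ ∃ m ∈ P ∪ M,
        ReachIn (redirect r u N P M Q) (free u N \ {m} ∪ insert u s) x y)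

theorem union_insert_union (F s t : Set V) :
    (F ∪ insert u s) ∪ (F ∪ insert u t) = F ∪ insert u (s ∪ t) := by
  ext; simp; tauto

/-- Three and two vertices of `N` add up to five. When both bounds are needed, the way from `u`
misses some end `m`, and the way to `u` can be chosen to miss that same `m`. -/
theorem IsSplit.balanced (h : Hub r u N P M) (hQ : IsSplit r u N P M Q)
    (hP : P.Nonempty ∨ ¬ (P ∪ M).Nontrivial) : Balanced r u N P M Q := by
  intro x y
  have key : ∀ {F s t : Set V} {i j : ℕ}, s ⊆ N → t ⊆ N → s.ncard ≤ i → t.ncard ≤ j →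
      ReachIn (redirect r u N P M Q) (F ∪ insert u s) x u →
      ReachIn (redirect r u N P M Q) (F ∪ insert u t) u y →
      s ∪ t ⊆ N ∧ (s ∪ t).ncard ≤ i + j ∧
        ReachIn (redirect r u N P M Q) (F ∪ insert u (s ∪ t)) x y := by
    intro F s t i j hs ht hi hj h1 h2
    refine ⟨Set.union_subset hs ht, (Set.ncard_union_le s t).trans (by omega), ?_⟩
    rw [← union_insert_union]
    exact h1.union_trans h2
  rcases hQ.exists_reachIn_hub h x with ⟨s, hs, hs2, h1⟩ | ⟨s, hs, hs3, h1, h1'⟩ <;>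
  rcases hQ.exists_hub_reachIn h y with ⟨t, ht, ht1, h2⟩ | ⟨t, ht, ht2, h2, h2'⟩
  · obtain ⟨k1, k2, k3⟩ := key hs ht hs2 ht1 h1 h2
    exact ⟨⟨_, k1, by omega, k3⟩, fun _ => .inl ⟨_, k1, by omega, k3⟩⟩
  · obtain ⟨k1, k2, k3⟩ := key hs ht hs2 ht2 h1 h2
    exact ⟨⟨_, k1, by omega, k3⟩, fun _ => .inl ⟨_, k1, by omega, k3⟩⟩
  · obtain ⟨k1, k2, k3⟩ := key hs ht hs3 ht1 h1 h2
    exact ⟨⟨_, k1, by omega, k3⟩, fun _ => .inl ⟨_, k1, by omega, k3⟩⟩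
  · refine ⟨⟨_, key hs ht hs3 ht2 h1 h2⟩, fun hnt => .inr ?_⟩
    obtain ⟨m, hm, h3⟩ := h2' (hP.resolve_right (not_not.2 hnt))
    obtain ⟨k1, k2, k3⟩ := key hs ht hs3 ht2 (h1' hnt m hm) h3
    exact ⟨_, k1, k2, m, hm, k3⟩

theorem _root_.ReachIn.swap {X : Set V} {x y : V} (h : ReachIn r X x y) :
    ReachIn (Function.swap r) X y x := by
  obtain ⟨hx, h⟩ := h
  induction h with
  | refl => exact .refl hx
  | tail hb hbc ih => exact (ReachIn.single hbc.2 ih.1 hbc.1).trans ih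

theorem redirect_swap (hQ : Q ⊆ N) :
    Function.swap (redirect (Function.swap r) u N M P Q) = redirect r u N P M (N \ Q) := by
  ext a b
  have := @hQ b
  simp only [redirect, Function.swap, Set.mem_sdiff]
  tauto

/-- The way from `u` needs a fixed arc out of `u`. If all fixed arcs enter `u`, reverse every arc;
this exchanges `P` with `M` and `Q` with its complement in `N`. -/
theorem exists_balanced [Finite V] (h : Hub r u N P M) : ∃ Q ⊆ N, Balanced r u N P M Q := by
  by_cases hP : P.Nonempty ∨ ¬ (P ∪ M).Nontrivial
  · obtain ⟨Q, hQ⟩ := h.exists_isSplit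
    exact ⟨Q, hQ.subset, hQ.balanced h hP⟩
  · obtain ⟨Q, hQ⟩ := h.swap.exists_isSplit
    have hM : M.Nonempty := by
      rw [not_or, not_not, Set.not_nonempty_iff_eq_empty] at hP
      have := hP.2.nonempty
      rwa [hP.1, Set.empty_union] at this
    have hb := hQ.balanced h.swap (.inl hM)
    refine ⟨N \ Q, Set.sdiff_subset, fun x y => ?_⟩
    rw [← redirect_swap hQ.subset, Set.union_comm P M]
    obtain ⟨⟨s, hs, hs5, h1⟩, h2⟩ := hb y x
    refine ⟨⟨s, hs, hs5, h1.swap⟩, fun hnt => ?_⟩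
    rcases h2 hnt with ⟨s, hs, hs4, h3⟩ | ⟨s, hs, hs5, m, hm, h3⟩
    · exact .inl ⟨s, hs, hs4, h3.swap⟩
    · exact .inr ⟨s, hs, hs5, m, hm, h3.swap⟩

end Hub

/-! ### The bound for bipartite mixed graphs -/

theorem ReachIn.mono_rel {V : Type*} {r r' : V → V → Prop} {X : Set V} {x y : V}
    (h : ReachIn r X x y) (hr : ∀ a b, r a b → r' a b) : ReachIn r' X x y :=
  ⟨h.1, ReflTransGen.mono (fun a b hab => ⟨hr a b hab.1, hab.2⟩) _ _ h.2⟩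

namespace MixedGraph

variable {V : Type*} {G : MixedGraph V} {A : Set V} {u : V}

/-- Here `s` is the set of vertices of `N` that a walk may use and `C` a set of vertices of `A` that
it misses; each missed vertex pays for one used vertex of `N`. -/
theorem ncard_inter_le [Finite V] {N s W C : Set V} {u : V} {k : ℕ} (hN : N ⊆ A) (hu : u ∉ A)
    (hC : C ⊆ A \ N) (hk : s.ncard ≤ k) (hW : W ⊆ Hub.free u N \ C ∪ insert u s) :
    (A ∩ W).ncard + C.ncard ≤ A.ncard - N.ncard + k := by
  have h1 : A ∩ W ⊆ (A \ N) \ C ∪ s := by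
    rintro x ⟨hxA, hxW⟩
    rcases hW hxW with hx | rfl | hx
    · exact .inl ⟨⟨hxA, hx.1.1⟩, hx.2⟩
    · exact absurd hxA hu
    · exact .inr hx
  have h2 := (Set.ncard_le_ncard h1 (Set.toFinite _)).trans (Set.ncard_union_le _ _)
  have h3 := Set.ncard_sdiff_add_ncard_of_subset hC (Set.toFinite _)
  have h4 := Set.ncard_sdiff_add_ncard_of_subset hN (Set.toFinite _)
  omega

theorem step_iff_of_isDirected {D : MixedGraph V} (hD : D.IsDirected) {a b : V} :
    D.Step a b ↔ D.arc a b :=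
  or_iff_right (hD a b)

theorem IsOrientation.adj_of_step {D : MixedGraph V} (hD : D.IsOrientation G) {a b : V}
    (h : D.Step a b) : G.underlying.Adj a b := by
  rw [step_iff_of_isDirected hD.isDirected] at h
  rcases hD.of_arc a b h with h | h
  · exact .inr (.inl h)
  · exact .inl h

theorem hub_of_isStrongOrientation {D : MixedGraph V} (hD : D.IsStrongOrientation G) (u : V) :
    Hub D.arc u {v | G.edge.Adj u v} {v | G.arc u v} {v | G.arc v u} where
  strong x y := ReflTransGen.mono (fun _ _ => (step_iff_of_isDirected hD.1.isDirected).1) _ _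
    (isConnected_iff.1 hD.2 x y)
  out_mem v h := (hD.1.of_arc u v h).symm
  in_mem v h := (hD.1.of_arc v u h).symm.imp_left fun h => h.symm
  asymm := D.arc_asymm u
  arc_or v h := hD.1.arc_of_edge u v h
  left_arc v h := hD.1.arc_of_arc u v h
  right_arc v h := hD.1.arc_of_arc v u h
  left_disj v h := G.not_edge_of_arc u v h
  right_disj v h h' := G.not_edge_of_arc v u h h'.symm

/-- The orientation obtained from `D` by redirecting the undirected edges of `G` at `u`: into `u`
from the vertices of `Q`, out of `u` to the other ones. -/
def redirectAt (D : MixedGraph V) {Q : Set V}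
    (hQ : Q ⊆ {v | G.edge.Adj u v}) : MixedGraph V where
  edge := ⊥
  arc := Hub.redirect D.arc u {v | G.edge.Adj u v} {v | G.arc u v} {v | G.arc v u} Q
  arc_irrefl := by
    rintro x (⟨-, -, h⟩ | ⟨rfl, h | ⟨h, -⟩⟩ | ⟨rfl, h | h⟩)
    · exact D.arc_irrefl x h
    · exact G.arc_irrefl _ h
    · exact G.edge.irrefl h
    · exact G.arc_irrefl _ h
    · exact G.edge.irrefl (hQ h)
  arc_asymm := by
    have key : ∀ b, (G.arc u b ∨ (G.edge.Adj u b ∧ b ∉ Q)) → ¬ (G.arc b u ∨ b ∈ Q) := by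
      rintro b (h | h) (h' | h')
      · exact G.arc_asymm _ _ h h'
      · exact G.not_edge_of_arc _ _ h (hQ h')
      · exact G.not_edge_of_arc _ _ h' h.1.symm
      · exact h.2 h'
    rintro x y (⟨hx, hy, h⟩ | ⟨rfl, h⟩ | ⟨rfl, h⟩) (⟨hx', hy', h'⟩ | ⟨h1, h'⟩ | ⟨h1, h'⟩)
    · exact D.arc_asymm _ _ h h'
    · exact hy h1
    · exact hx h1
    · exact hy' rfl
    · subst h1
      rcases h with h | h
      · exact G.arc_irrefl _ h
      · exact G.edge.irrefl h.1
    · exact key _ h h'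
    · exact hx' rfl
    · exact key _ h' h
    · subst h1
      rcases h with h | h
      · exact G.arc_irrefl _ h
      · exact G.edge.irrefl (hQ h)
  not_edge_of_arc _ _ _ h := h

theorem isOrientation_redirectAt {D : MixedGraph V} (hD : D.IsOrientation G) {Q : Set V}
    (hQ : Q ⊆ {v | G.edge.Adj u v}) : (redirectAt D hQ).IsOrientation G where
  isDirected _ _ h := h
  arc_of_arc x y h := by
    by_cases hx : x = u
    · subst hx; exact .inr (.inl ⟨rfl, .inl h⟩)
    by_cases hy : y = u
    · subst hy; exact .inr (.inr ⟨rfl, .inl h⟩)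
    exact .inl ⟨hx, hy, hD.arc_of_arc x y h⟩
  arc_of_edge x y h := by
    by_cases hx : x = u
    · subst hx
      by_cases hyQ : y ∈ Q
      · exact .inr (.inr (.inr ⟨rfl, .inr hyQ⟩))
      · exact .inl (.inr (.inl ⟨rfl, .inr ⟨h, hyQ⟩⟩))
    by_cases hy : y = u
    · subst hy
      by_cases hxQ : x ∈ Q
      · exact .inl (.inr (.inr ⟨rfl, .inr hxQ⟩))
      · exact .inr (.inr (.inl ⟨rfl, .inr ⟨h.symm, hxQ⟩⟩))
    exact (hD.arc_of_edge x y h).imp (fun h => .inl ⟨hx, hy, h⟩) (fun h => .inl ⟨hy, hx, h⟩)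
  of_arc x y h := by
    rcases h with ⟨-, -, h⟩ | ⟨rfl, h | ⟨h, -⟩⟩ | ⟨rfl, h | h⟩
    · exact hD.of_arc x y h
    · exact .inl h
    · exact .inr h
    · exact .inl h
    · exact .inr (hQ h).symm

theorem dist_le_of_reachIn [Finite V] (hA : ∀ a b, G.Step a b → (a ∈ A ↔ b ∉ A)) {X : Set V}
    {x y : V} {k : ℕ} (h : ReachIn G.Step X x y) (hk : (A ∩ X).ncard ≤ k) :
    G.dist x y ≤ (2 * k : ℕ) := by
  classical
  refine le_self_add.trans ((dist_add_le_of_reachIn hA h).trans ?_)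
  exact_mod_cast Nat.mul_le_mul_left 2 hk

/-- A bound for the oriented diameter of a bipartite bridgeless mixed graph in terms of the
undirected degree of a vertex outside of the part `A`. -/
theorem exists_isStrongOrientation_dist_le [Finite V] (hG : G.IsBridgeless)
    (hA : ∀ a b, G.underlying.Adj a b → (a ∈ A ↔ b ∉ A)) (hu : u ∉ A) :
    ∃ D : MixedGraph V, D.IsStrongOrientation G ∧
      (∀ x y, D.dist x y ≤ (2 * (A.ncard - G.undirDegree u + 5) : ℕ)) ∧
      (2 ≤ G.outDegree u + G.inDegree u →
        ∀ x y, D.dist x y ≤ (2 * (A.ncard - G.undirDegree u + 4) : ℕ)) := by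
  obtain ⟨D, hD⟩ := hG.exists_isStrongOrientation
  obtain ⟨Q, hQ, hb⟩ := (hub_of_isStrongOrientation hD u).exists_balanced
  have hO := isOrientation_redirectAt hD.1 hQ
  have hA' : ∀ a b, (redirectAt D hQ).Step a b → (a ∈ A ↔ b ∉ A) := fun a b h =>
    hA a b (hO.adj_of_step h)
  have hN : {v | G.edge.Adj u v} ⊆ A := fun v hv => by
    have := hA u v (.inl hv)
    tauto
  have hstep : ∀ {X x y}, ReachIn (Hub.redirect D.arc u {v | G.edge.Adj u v} {v | G.arc u v}
      {v | G.arc v u} Q) X x y → ReachIn (redirectAt D hQ).Step X x y :=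
    fun h => h.mono_rel fun _ _ hab => .inr hab
  refine ⟨redirectAt D hQ, ⟨hO, ?_⟩, fun x y => ?_, fun hdeg x y => ?_⟩
  · intro x y
    obtain ⟨⟨s, -, -, h⟩, -⟩ := hb x y
    obtain ⟨l, hl, -⟩ := exists_isOrientablePath_of_reachIn (hstep h)
    exact ⟨l, hl⟩
  · obtain ⟨⟨s, hs, hs5, h⟩, -⟩ := hb x y
    exact dist_le_of_reachIn hA' (hstep h)
      (by simpa [undirDegree] using ncard_inter_le (C := ∅) hN hu (by simp) hs5 (by simp))
  · have hnt : ({v | G.arc u v} ∪ {v | G.arc v u}).Nontrivial := by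
      rw [← Set.one_lt_ncard_iff_nontrivial, Set.ncard_union_eq]
      · exact hdeg
      · exact Set.disjoint_left.2 fun v h h' => G.arc_asymm _ _ h h'
    rcases (hb x y).2 hnt with ⟨s, hs, hs4, h⟩ | ⟨s, hs, hs5, m, hm, h⟩
    · exact dist_le_of_reachIn hA' (hstep h)
        (by simpa [undirDegree] using ncard_inter_le (C := ∅) hN hu (by simp) hs4 (by simp))
    · have hmA : m ∈ A \ {v | G.edge.Adj u v} := by
        rcases hm with hm | hm
        · have := hA u m (.inr (.inl hm))
          exact ⟨by tauto, G.not_edge_of_arc _ _ hm⟩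
        · have := hA u m (.inr (.inr hm))
          exact ⟨by tauto, fun h' => G.not_edge_of_arc _ _ hm h'.symm⟩
      have hc := ncard_inter_le (C := {m}) hN hu (by simpa using hmA) hs5 subset_rfl
      refine dist_le_of_reachIn hA' (hstep h) ?_
      rw [Set.ncard_singleton] at hc
      simp only [undirDegree]
      omega

end MixedGraph

/-! ### Undirected graphs: the components away from a vertex and its neighbours -/

namespace MixedGraph

variable {V : Type*} {G : MixedGraph V} {A : Set V} {u : V}

/-- The neighbours of `u` along undirected edges. -/
def hub (G : MixedGraph V) (u : V) : Set V := {v | G.edge.Adj u v}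

/-- The vertices different from `u` that are not joined to `u` by an undirected edge. -/
def outer (G : MixedGraph V) (u : V) : Set V := Hub.free u (G.hub u)

/-- Adjacency, by undirected edges, of the vertices in `G.outer u`. -/
def Link (G : MixedGraph V) (u a b : V) : Prop :=
  G.edge.Adj a b ∧ a ∈ G.outer u ∧ b ∈ G.outer u

/-- The component of `x` in the graph induced by `G.outer u`. -/
def comp (G : MixedGraph V) (u x : V) : Set V := {c | ReflTransGen (G.Link u) x c}

/-- The vertices in `G.hub u` with a neighbour in the component of `x`. -/
def att (G : MixedGraph V) (u x : V) : Set V :=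
  {v | v ∈ G.hub u ∧ ∃ c ∈ G.comp u x, G.edge.Adj c v}

theorem mem_comp_self (x : V) : x ∈ G.comp u x := ReflTransGen.refl

theorem comp_subset {x : V} (hx : x ∈ G.outer u) : G.comp u x ⊆ G.outer u := by
  intro c hc
  induction (show ReflTransGen (G.Link u) x c from hc) with
  | refl => exact hx
  | tail _ h _ => exact h.2.2

theorem comp_eq {x c : V} (hc : c ∈ G.comp u x) : G.comp u c = G.comp u x := by
  have hs : ReflTransGen (G.Link u) c x := by
    have hc' : ReflTransGen (G.Link u) x c := hc
    induction hc' with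
    | refl => exact .refl
    | tail h1 h ih => exact .head ⟨h.1.symm, h.2.2, h.2.1⟩ (ih h1)
  ext d
  exact ⟨fun hd => ReflTransGen.trans hc hd, fun hd => hs.trans hd⟩

theorem att_eq {x c : V} (hc : c ∈ G.comp u x) : G.att u c = G.att u x := by
  simp only [att, comp_eq hc]

theorem mem_comp_of_adj {x c d : V} (hx : x ∈ G.outer u) (hc : c ∈ G.comp u x)
    (hd : d ∈ G.outer u) (h : G.edge.Adj c d) : d ∈ G.comp u x :=
  ReflTransGen.tail hc ⟨h, comp_subset hx hc, hd⟩

theorem not_adj_of_mem_outer {x : V} (hx : x ∈ G.outer u) : ¬ G.edge.Adj x u :=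
  fun h => hx.1 h.symm

theorem mem_att_of_adj {x c z : V} (hx : x ∈ G.outer u) (hc : c ∈ G.comp u x)
    (h : G.edge.Adj c z) (hz : z ∉ G.comp u x) : z ∈ G.att u x := by
  by_cases hzN : z ∈ G.hub u
  · exact ⟨hzN, c, hc, h⟩
  · by_cases hzu : z = u
    · exact absurd (hzu ▸ h) (not_adj_of_mem_outer (comp_subset hx hc))
    · exact absurd (mem_comp_of_adj hx hc ⟨hzN, hzu⟩ h) hz

/-- A walk out of a component ends in an attachment. -/
theorem exists_via_att {r : V → V → Prop} (hr : ∀ a b, r a b → G.edge.Adj a b)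
    (hs : ∀ a b, ReflTransGen r a b) {x : V} (hx : x ∈ G.outer u) :
    ∃ v ∈ G.att u x, Via r (G.comp u x) x v ∧ ∃ c ∈ G.comp u x, r c v := by
  obtain ⟨z, hz, hv⟩ := exists_first_visit (X := G.comp u x) (hs x u) (mem_comp_self x)
    (fun h => (comp_subset hx h).2 rfl)
  obtain ⟨c, hc, hcz⟩ := id hv
  have hcm : c ∈ G.comp u x := by
    rcases ReflTransGen.cases_tail hc with rfl | ⟨b, -, hb⟩
    · exact mem_comp_self c
    · exact hb.2
  exact ⟨z, mem_att_of_adj hx hcm (hr _ _ hcz) hz, hv, c, hcm, hcz⟩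

theorem IsUndirected.adj_of_step (hU : G.IsUndirected) {a b : V} (h : G.Step a b) :
    G.edge.Adj a b :=
  h.resolve_right (hU a b)

theorem reflTransGen_adj (hG : G.IsBridgeless) (hU : G.IsUndirected) (x y : V) : ReflTransGen G.edge.Adj x y :=
  ReflTransGen.mono (fun _ _ h => hU.adj_of_step h) _ _ (isConnected_iff.1 hG.1 x y)

theorem att_nonempty (hG : G.IsBridgeless) (hU : G.IsUndirected) {x : V} (hx : x ∈ G.outer u) : (G.att u x).Nonempty := by
  obtain ⟨v, hv, -⟩ := exists_via_att (fun _ _ h => h) (reflTransGen_adj hG hU) hx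
  exact ⟨v, hv⟩

/-- A set of vertices that is left by one undirected edge only contains all vertices. -/
theorem mem_of_closed (hG : G.IsBridgeless) (hU : G.IsUndirected) {a b : V} (hab : G.edge.Adj a b) {Z : Set V} (ha : a ∈ Z)
    (hZ : ∀ c ∈ Z, ∀ d, G.edge.Adj c d → s(c, d) ≠ s(a, b) → d ∈ Z) (c : V) : c ∈ Z := by
  have hc : (G.deleteEdge s(a, b)).underlying.Connected := by
    by_contra hc
    exact hG.2 _ ⟨hab, hc⟩
  have := hc.preconnected a c
  rw [SimpleGraph.reachable_iff_reflTransGen] at this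
  induction this with
  | refl => exact ha
  | @tail c d _ h ih =>
    rcases h with h | h | h
    · have h' : G.edge.Adj c d ∧ s(c, d) ≠ s(a, b) := by simpa [deleteEdge] using h
      exact hZ c ih d h'.1 h'.2
    · exact absurd h (hU _ _)
    · exact absurd h (hU _ _)

theorem hub_subset (hA : ∀ a b, G.edge.Adj a b → (a ∈ A ↔ b ∉ A)) (hu : u ∉ A) :
    G.hub u ⊆ A := fun v hv => not_not.1 fun hvA => hu ((hA u v hv).2 hvA)

/-- Every neighbour of `u` shares a component with another one. -/
theorem exists_mem_att_ne (hG : G.IsBridgeless) (hU : G.IsUndirected)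
    (hA : ∀ a b, G.edge.Adj a b → (a ∈ A ↔ b ∉ A)) (hu : u ∉ A) {v : V} (hv : v ∈ G.hub u) :
    ∃ c ∈ G.outer u, v ∈ G.att u c ∧ ∃ w ∈ G.att u c, w ≠ v := by
  by_contra! hcon
  have hvA := hub_subset hA hu hv
  have hvu : v ≠ u := fun h => hu (h ▸ hvA)
  -- Otherwise `v` together with all components attached to it is left only by the edge `vu`, which
  -- would be a bridge.
  have := mem_of_closed hG hU (a := v) (b := u) (show G.edge.Adj u v from hv).symm
    (Z := insert v {c | c ∈ G.outer u ∧ v ∈ G.att u c}) (by simp) (by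
      rintro c (rfl | ⟨hc, hvc⟩) d hcd hne
      · have hdu : d ≠ u := by
          rintro rfl
          exact hne rfl
        have hdN : d ∉ G.hub u := fun hd =>
          (hA c d hcd).1 hvA (hub_subset hA hu hd)
        exact .inr ⟨⟨hdN, hdu⟩, hv, d, mem_comp_self d, hcd.symm⟩
      · by_cases hd : d ∈ G.comp u c
        · exact .inr ⟨comp_subset hc hd, by rwa [att_eq hd]⟩
        · exact .inl (hcon c hc hvc d (mem_att_of_adj hc (mem_comp_self c) hcd hd))) u
  rcases this with h | h
  · exact hvu h.symm
  · exact h.1.2 rfl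

/-- A component with only one attachment contains a vertex of the part of the attachment. -/
theorem exists_mem_comp_mem (hG : G.IsBridgeless) (hU : G.IsUndirected)
    (hA : ∀ a b, G.edge.Adj a b → (a ∈ A ↔ b ∉ A)) {x p : V} (hx : x ∈ G.outer u) (hp : G.att u x = {p}) :
    ∃ m ∈ G.comp u x, m ∈ A := by
  by_contra! hcon
  have hpx : p ∈ G.att u x := by simp [hp]
  -- Without a vertex of `A` the component has no edge, so it is the single vertex `x`, and `xp`
  -- would be a bridge.
  have hnb : ∀ d, G.edge.Adj x d → d = p := by
    intro d hd
    have hdc : d ∉ G.comp u x := fun h => by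
      have h1 := hcon x (mem_comp_self x)
      have h2 := hcon d h
      have := hA x d hd
      tauto
    have := mem_att_of_adj hx (mem_comp_self x) hd hdc
    rwa [hp] at this
  have hxp : G.edge.Adj x p := by
    obtain ⟨-, c, hc, hcp⟩ := hpx
    rcases ReflTransGen.cases_head hc with rfl | ⟨d, hd, -⟩
    · exact hcp
    · exact hnb d hd.1 ▸ hd.1
  have := mem_of_closed hG hU hxp (Z := {x}) rfl (by
    rintro c rfl d hd hne
    exact absurd (by rw [hnb d hd]) hne) u
  exact hx.2 this.symm

/-- Two neighbours of `u` share a component. -/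
def Share (G : MixedGraph V) (u v w : V) : Prop :=
  v ≠ w ∧ ∃ c ∈ G.outer u, v ∈ G.att u c ∧ w ∈ G.att u c

theorem Share.symm {v w : V} (h : G.Share u v w) : G.Share u w v :=
  ⟨h.1.symm, let ⟨c, hc, h1, h2⟩ := h.2; ⟨c, hc, h2, h1⟩⟩

/-- The prescribed part `I₀` serves to force certain attachments into `I`; maximality makes `I`
dominating. -/
theorem exists_maximal_independent [Finite V] {N : Set V} {K : V → V → Prop}
    (hsymm : ∀ a b, K a b → K b a) (hirr : ∀ a, ¬ K a a)
    {I₀ : Set V} (hI₀ : I₀ ⊆ N) (hind : ∀ a ∈ I₀, ∀ b ∈ I₀, ¬ K a b) :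
    ∃ I, I₀ ⊆ I ∧ I ⊆ N ∧ (∀ a ∈ I, ∀ b ∈ I, ¬ K a b) ∧ ∀ w ∈ N, w ∉ I → ∃ v ∈ I, K v w := by
  obtain ⟨I, hI₀I, ⟨hIN, hI⟩, hmax⟩ := Finite.exists_le_maximal
    (p := fun I : Set V => I ⊆ N ∧ ∀ a ∈ I, ∀ b ∈ I, ¬ K a b) ⟨hI₀, hind⟩
  refine ⟨I, hI₀I, hIN, hI, fun w hw hwI => ?_⟩
  by_contra! hcon
  refine hwI (hmax (y := insert w I) ⟨Set.insert_subset hw hIN, ?_⟩ (Set.subset_insert w I)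
    (Set.mem_insert w I))
  rintro a (rfl | ha) b (rfl | hb)
  · exact hirr _
  · exact fun h => hcon b hb (hsymm _ _ h)
  · exact hcon a ha
  · exact hI a ha b hb

end MixedGraph

/-! ### Colourings of the neighbours and the directions they prescribe -/

namespace MixedGraph

variable {V : Type*} {G : MixedGraph V} {A I : Set V} {u : V}

/-- The component of `c` has attachments inside and outside of `I`. -/
def IsMixed (G : MixedGraph V) (u : V) (I : Set V) (c : V) : Prop :=
  c ∈ G.outer u ∧ (∃ v ∈ G.att u c, v ∈ I) ∧ ∃ w ∈ G.att u c, w ∉ I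

theorem IsMixed.of_mem_comp {c d : V} (h : G.IsMixed u I c) (hd : d ∈ G.comp u c) :
    G.IsMixed u I d := by
  rw [IsMixed, att_eq hd]
  exact ⟨comp_subset h.1 hd, h.2⟩

/-- Each neighbour of `u` is attached to a component with attachments inside and outside of `I`. -/
def IsColoring (G : MixedGraph V) (u : V) (I : Set V) : Prop :=
  I ⊆ G.hub u ∧ ∀ v ∈ G.hub u, ∃ c, v ∈ G.att u c ∧ G.IsMixed u I c

/-- A maximal independent set without isolated vertices around is dominating, and so is its
complement; the component shared by two `K`-neighbours of different colours is mixed. -/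
theorem isColoring_of_independent {K : V → V → Prop} (hK : ∀ v w, K v w → G.Share u v w)
    (hN : ∀ v ∈ G.hub u, ∃ w ∈ G.hub u, K v w) (hI : I ⊆ G.hub u)
    (hind : ∀ a ∈ I, ∀ b ∈ I, ¬ K a b) (hmax : ∀ w ∈ G.hub u, w ∉ I → ∃ v ∈ I, K v w) :
    G.IsColoring u I := by
  refine ⟨hI, fun v hv => ?_⟩
  by_cases hvI : v ∈ I
  · obtain ⟨w, -, hvw⟩ := hN v hv
    obtain ⟨-, c, hc, h1, h2⟩ := hK v w hvw
    exact ⟨c, h1, hc, ⟨v, h1, hvI⟩, w, h2, fun hw => hind v hvI w hw hvw⟩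
  · obtain ⟨w, hw, hwv⟩ := hmax v hv hvI
    obtain ⟨-, c, hc, h1, h2⟩ := hK w v hwv
    exact ⟨c, h2, hc, ⟨w, h1, hw⟩, v, h2, hvI⟩

theorem exists_share (hG : G.IsBridgeless) (hU : G.IsUndirected)
    (hA : ∀ a b, G.edge.Adj a b → (a ∈ A ↔ b ∉ A)) (hu : u ∉ A) {v : V} (hv : v ∈ G.hub u) :
    ∃ w ∈ G.hub u, G.Share u v w := by
  obtain ⟨c, hc, hvc, w, hw, hne⟩ := exists_mem_att_ne hG hU hA hu hv
  exact ⟨w, hw.1, hne.symm, c, hc, hvc, hw⟩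

/-- The neighbours of `u` can be coloured such that of any two components, one with all attachments
in `I` and the other one with no attachment in `I`, there is a vertex of `A` outside of these two
components and of the mixed components, or else the two components have only one attachment each,
and these two vertices are the attachments of a third component. -/
theorem exists_isColoring [Finite V] (hG : G.IsBridgeless) (hU : G.IsUndirected)
    (hA : ∀ a b, G.edge.Adj a b → (a ∈ A ↔ b ∉ A)) (hu : u ∉ A) :
    ∃ I, G.IsColoring u I ∧ ∀ x ∈ G.outer u, ∀ y ∈ G.outer u, G.att u x ⊆ I →
      (∀ v ∈ G.att u y, v ∉ I) →
      (∃ m ∈ A, m ∈ G.outer u ∧ m ∉ G.comp u x ∧ m ∉ G.comp u y ∧ ¬ G.IsMixed u I m) ∨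
      ∃ c p q, G.IsMixed u I c ∧ G.att u x = {p} ∧ G.att u y = {q} ∧ G.att u c = {p, q} := by
  -- A component with one attachment is never mixed and contains a vertex of `A`. So any third such
  -- component settles the first alternative (`hmiss`).
  let Single : Set V := {z | z ∈ G.outer u ∧ ∃ p, G.att u z = {p}}
  have hmiss : ∀ {I : Set V} {x y z : V}, z ∈ Single → z ∉ G.comp u x → z ∉ G.comp u y →
      ∃ m ∈ A, m ∈ G.outer u ∧ m ∉ G.comp u x ∧ m ∉ G.comp u y ∧ ¬ G.IsMixed u I m := by
    rintro I x y z ⟨hz, p, hp⟩ hzx hzy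
    obtain ⟨m, hm, hmA⟩ := exists_mem_comp_mem hG hU hA hz hp
    have hzm : z ∈ G.comp u m := by rw [comp_eq hm]; exact mem_comp_self z
    refine ⟨m, hmA, comp_subset hz hm, fun h => hzx (comp_eq h ▸ hzm),
      fun h => hzy (comp_eq h ▸ hzm), ?_⟩
    rintro ⟨-, ⟨a, ha, haI⟩, b, hb, hbI⟩
    rw [att_eq hm, hp] at ha hb
    rw [ha] at haI
    rw [hb] at hbI
    exact hbI haI
  have hsingle : ∀ {I : Set V} {x : V}, (∀ a ∈ I, ∀ b ∈ I, ¬ G.Share u a b) →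
      x ∈ G.outer u → G.att u x ⊆ I → ∃ p ∈ I, G.att u x = {p} := by
    intro I x hI hx hxI
    obtain ⟨p, hp⟩ := att_nonempty hG hU hx
    refine ⟨p, hxI hp, Set.eq_singleton_iff_unique_mem.2 ⟨hp, fun q hq => ?_⟩⟩
    by_contra hne
    exact hI q (hxI hq) p (hxI hp) ⟨hne, x, hx, hq, hp⟩
  have hshare : ∀ v w, G.Share u v w → G.Share u w v := fun _ _ h => h.symm
  have hirr : ∀ v, ¬ G.Share u v v := fun v h => h.1 rfl
  -- Only one component has a single attachment `v`: put a vertex sharing a component with `v` into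
  -- `I`, so that `v ∉ I` and no component is attached to `I` only.
  by_cases h1 : ∃ c ∈ Single, Single ⊆ G.comp u c
  · obtain ⟨c, ⟨hc, v, hv⟩, hcS⟩ := h1
    have hvc : v ∈ G.att u c := by simp [hv]
    obtain ⟨w, hw, hvw⟩ := exists_share hG hU hA hu hvc.1
    obtain ⟨I, hwI, hI, hind, hmax⟩ := exists_maximal_independent (N := G.hub u) hshare hirr
      (I₀ := {w}) (by simpa) (by rintro a rfl b rfl; exact hirr _)
    refine ⟨I, isColoring_of_independent (fun _ _ h => h)
      (fun v hv => exists_share hG hU hA hu hv) hI hind hmax, fun x hx y hy hxI hyI => ?_⟩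
    obtain ⟨p, hp, hxp⟩ := hsingle hind hx hxI
    have hxc := hcS ⟨hx, p, hxp⟩
    rw [att_eq hxc, hv, Set.singleton_eq_singleton_iff] at hxp
    exact absurd hvw (hind v (hxp ▸ hp) w (hwI rfl))
  -- Just two such components, with attachments that are not joined by a component attached exactly
  -- to them: put both attachments into `I`. Then neither is the component of `y`, and at most one
  -- is that of `x`.
  by_cases h2 : ∃ c₁ c₂ v₁ v₂, c₁ ∈ G.outer u ∧ c₂ ∈ G.outer u ∧ G.att u c₁ = {v₁} ∧
      G.att u c₂ = {v₂} ∧ v₁ ≠ v₂ ∧ Single ⊆ G.comp u c₁ ∪ G.comp u c₂ ∧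
      ∀ c ∈ G.outer u, G.att u c ≠ {v₁, v₂}
  · obtain ⟨c₁, c₂, v₁, v₂, hc₁, hc₂, hv₁, hv₂, hne, hS, hno⟩ := h2
    -- Dropping the pair `v₁`, `v₂` makes it independent. Nothing becomes isolated, since any
    -- component attached to both has a third attachment.
    let K : V → V → Prop := fun a b => G.Share u a b ∧ ¬ (a = v₁ ∧ b = v₂) ∧ ¬ (a = v₂ ∧ b = v₁)
    have hKsymm : ∀ a b, K a b → K b a := fun a b h =>
      ⟨h.1.symm, fun h' => h.2.2 ⟨h'.2, h'.1⟩, fun h' => h.2.1 ⟨h'.2, h'.1⟩⟩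
    have hv₁c : v₁ ∈ G.att u c₁ := by simp [hv₁]
    have hv₂c : v₂ ∈ G.att u c₂ := by simp [hv₂]
    have hthird : ∀ c ∈ G.outer u, v₁ ∈ G.att u c → v₂ ∈ G.att u c →
        ∃ t ∈ G.att u c, t ≠ v₁ ∧ t ≠ v₂ := by
      intro c hc h1 h2
      by_contra! hcon
      refine hno c hc (Set.Subset.antisymm (fun t ht => ?_) (Set.pair_subset h1 h2))
      by_cases h : t = v₁
      · exact .inl h
      · exact .inr (hcon t ht h)
    have hKN : ∀ v ∈ G.hub u, ∃ w ∈ G.hub u, K v w := by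
      intro v hv
      obtain ⟨w, hw, hvw⟩ := exists_share hG hU hA hu hv
      by_cases hK : K v w
      · exact ⟨w, hw, hK⟩
      · have hpair : (v = v₁ ∧ w = v₂) ∨ (v = v₂ ∧ w = v₁) := by
          by_contra hcon
          rw [not_or] at hcon
          exact hK ⟨hvw, hcon⟩
        obtain ⟨-, c, hc, hvc, hwc⟩ := hvw
        obtain ⟨t, ht, ht1, ht2⟩ : ∃ t ∈ G.att u c, t ≠ v₁ ∧ t ≠ v₂ := by
          rcases hpair with ⟨rfl, rfl⟩ | ⟨rfl, rfl⟩
          · exact hthird c hc hvc hwc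
          · exact hthird c hc hwc hvc
        refine ⟨t, ht.1, ⟨?_, c, hc, hvc, ht⟩, fun h => ht2 h.2, fun h => ht1 h.2⟩
        rintro rfl
        rcases hpair with h | h
        · exact ht1 h.1
        · exact ht2 h.1
    obtain ⟨I, hvI, hI, hind, hmax⟩ := exists_maximal_independent (N := G.hub u) hKsymm
      (fun a h => hirr a h.1) (I₀ := {v₁, v₂}) (Set.pair_subset hv₁c.1 hv₂c.1) (by
        rintro a (rfl | rfl) b (rfl | rfl) h
        · exact h.1.1 rfl
        · exact h.2.1 ⟨rfl, rfl⟩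
        · exact h.2.2 ⟨rfl, rfl⟩
        · exact h.1.1 rfl)
    have hv₁I : v₁ ∈ I := hvI (.inl rfl)
    have hv₂I : v₂ ∈ I := hvI (.inr rfl)
    refine ⟨I, isColoring_of_independent (fun _ _ h => h.1) hKN hI hind hmax,
      fun x hx y hy hxI hyI => .inl ?_⟩
    have hxS : x ∈ Single := by
      obtain ⟨p, hp⟩ := att_nonempty hG hU hx
      refine ⟨hx, p, Set.eq_singleton_iff_unique_mem.2 ⟨hp, fun q hq => ?_⟩⟩
      by_contra hqp
      by_cases hK : K q p
      · exact hind q (hxI hq) p (hxI hp) hK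
      · have hpair : (q = v₁ ∧ p = v₂) ∨ (q = v₂ ∧ p = v₁) := by
          by_contra hcon
          rw [not_or] at hcon
          exact hK ⟨⟨hqp, x, hx, hq, hp⟩, hcon⟩
        have h12 : v₁ ∈ G.att u x ∧ v₂ ∈ G.att u x := by
          rcases hpair with ⟨rfl, rfl⟩ | ⟨rfl, rfl⟩
          · exact ⟨hq, hp⟩
          · exact ⟨hp, hq⟩
        obtain ⟨t, ht, ht1, ht2⟩ := hthird x hx h12.1 h12.2
        exact hind t (hxI ht) v₁ hv₁I ⟨⟨ht1, x, hx, ht, h12.1⟩, fun h => ht1 h.1,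
          fun h => ht2 h.1⟩
    have hy1 : c₁ ∉ G.comp u y := fun h => hyI v₁ (by rw [← att_eq h, hv₁]; rfl) hv₁I
    have hy2 : c₂ ∉ G.comp u y := fun h => hyI v₂ (by rw [← att_eq h, hv₂]; rfl) hv₂I
    have h12 : c₁ ∉ G.comp u x ∨ c₂ ∉ G.comp u x := by
      by_contra! hcon
      have := att_eq hcon.1
      rw [← att_eq hcon.2, hv₁, hv₂, Set.singleton_eq_singleton_iff] at this
      exact hne this
    rcases h12 with h | h
    · exact hmiss ⟨hc₁, v₁, hv₁⟩ h hy1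
    · exact hmiss ⟨hc₂, v₂, hv₂⟩ h hy2
  -- Any maximal independent set works. If no vertex is missed, the components of `x` and `y` are
  -- the only ones with a single attachment, and the failure of `h2` yields the connecting
  -- component.
  · obtain ⟨I, -, hI, hind, hmax⟩ := exists_maximal_independent (N := G.hub u) hshare hirr
      (I₀ := ∅) (by simp) (by simp)
    refine ⟨I, isColoring_of_independent (fun _ _ h => h)
      (fun v hv => exists_share hG hU hA hu hv) hI hind hmax, fun x hx y hy hxI hyI => ?_⟩
    obtain ⟨p, hp, hxp⟩ := hsingle hind hx hxI
    by_contra hcon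
    rw [not_or] at hcon
    have hcov : ∀ z ∈ Single, z ∉ G.comp u x → z ∈ G.comp u y := fun z hz hzx => by
      by_contra hzy
      exact hcon.1 (hmiss hz hzx hzy)
    obtain ⟨z, hz, hzx⟩ : ∃ z ∈ Single, z ∉ G.comp u x := by
      by_contra! h
      exact h1 ⟨x, ⟨hx, p, hxp⟩, h⟩
    obtain ⟨q, hq⟩ := hz.2
    have hyq : G.att u y = {q} := by rw [← hq, att_eq (hcov z hz hzx)]
    have hqI : q ∉ I := hyI q (by simp [hyq])
    refine h2 ⟨x, y, p, q, hx, hy, hxp, hyq, ?_, ?_, fun c hc hcpq => hcon.2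
      ⟨c, p, q, ⟨hc, ⟨p, by simp [hcpq], hp⟩, q, by simp [hcpq], hqI⟩, hxp, hyq, hcpq⟩⟩
    · rintro rfl
      exact hqI hp
    · intro z hz
      by_cases hzx : z ∈ G.comp u x
      · exact .inl hzx
      · exact .inr (hcov z hz hzx)

/-- The directions which a colouring prescribes. -/
def Prescribed (G : MixedGraph V) (u : V) (I : Set V) (a b : V) : Prop :=
  G.edge.Adj a b ∧ ((a = u ∧ b ∈ I) ∨ (b = u ∧ a ∉ I) ∨ (a ∈ I ∧ G.IsMixed u I b) ∨
    (G.IsMixed u I a ∧ b ∈ G.hub u ∧ b ∉ I))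

theorem Prescribed.asymm (hI : I ⊆ G.hub u) {a b : V} (h : G.Prescribed u I a b) :
    ¬ G.Prescribed u I b a := by
  have hself : u ∉ G.hub u := fun h => G.edge.irrefl h
  have key : ∀ c, (c = u → c ∉ I ∧ ¬ G.IsMixed u I c ∧ c ∉ G.hub u) ∧
      (G.IsMixed u I c → c ∉ I ∧ c ∉ G.hub u) := by
    refine fun c => ⟨?_, fun hc => ⟨fun h => hc.1.1 (hI h), hc.1.1⟩⟩
    rintro rfl
    exact ⟨fun h => hself (hI h), fun h => h.1.2 rfl, hself⟩
  have hne : a = u → ¬ b = u := by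
    rintro rfl rfl
    exact G.edge.irrefl h.1
  have ha := key a
  have hb := key b
  replace h := h.2
  intro h'
  replace h' := h'.2
  -- The remaining argument is propositional, with the equations `a = u` and `b = u` as atoms.
  clear key hself hI
  generalize (a = u) = p₁ at *
  generalize (b = u) = p₂ at *
  tauto

/-- The mixed graph in which the prescribed edges are directed. -/
def prescribe (G : MixedGraph V) (u : V) (I : Set V) (hI : I ⊆ G.hub u) : MixedGraph V where
  edge :=
    { Adj a b := G.edge.Adj a b ∧ ¬ G.Prescribed u I a b ∧ ¬ G.Prescribed u I b a
      symm := ⟨fun _ _ h => ⟨h.1.symm, h.2.2, h.2.1⟩⟩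
      loopless := ⟨fun _ h => G.edge.irrefl h.1⟩ }
  arc := G.Prescribed u I
  arc_irrefl _ h := G.edge.irrefl h.1
  arc_asymm _ _ h := h.asymm hI
  not_edge_of_arc _ _ h h' := h'.2.1 h

theorem step_prescribe (hI : I ⊆ G.hub u) {a b : V} (h : G.edge.Adj a b)
    (hba : ¬ G.Prescribed u I b a) : (G.prescribe u I hI).Step a b := by
  by_cases hab : G.Prescribed u I a b
  · exact .inr hab
  · exact .inl ⟨h, hab, hba⟩

theorem not_prescribed_of_outer (hI : I ⊆ G.hub u) {a b : V} (ha : a ∈ G.outer u)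
    (hb : b ∈ G.outer u) : ¬ G.Prescribed u I a b := by
  rintro ⟨-, ⟨rfl, -⟩ | ⟨rfl, -⟩ | ⟨h, -⟩ | ⟨-, h, -⟩⟩
  · exact ha.2 rfl
  · exact hb.2 rfl
  · exact ha.1 (hI h)
  · exact hb.1 h

theorem reflTransGen_prescribe_comp (hI : I ⊆ G.hub u) {x c : V} (hc : c ∈ G.comp u x) :
    ReflTransGen (G.prescribe u I hI).Step x c ∧ ReflTransGen (G.prescribe u I hI).Step c x := by
  induction (show ReflTransGen (G.Link u) x c from hc) with
  | refl => exact ⟨.refl, .refl⟩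
  | tail h1 h ih =>
    obtain ⟨h2, h3⟩ := ih h1
    exact ⟨h2.tail (step_prescribe hI h.1 (not_prescribed_of_outer hI h.2.2 h.2.1)),
      .head (step_prescribe hI h.1.symm (not_prescribed_of_outer hI h.2.1 h.2.2)) h3⟩

theorem not_prescribed_of_mem (hI : I ⊆ G.hub u) {c v : V} (hc : c ∈ G.outer u) (hv : v ∈ I) :
    ¬ G.Prescribed u I c v := by
  rintro ⟨-, ⟨rfl, -⟩ | ⟨rfl, -⟩ | ⟨h, -⟩ | ⟨-, -, h⟩⟩
  · exact hc.2 rfl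
  · exact G.edge.irrefl (hI hv)
  · exact hc.1 (hI h)
  · exact h hv

theorem not_prescribed_of_notMem {c v : V} (hI : I ⊆ G.hub u) (hc : c ∈ G.outer u)
    (hv : v ∈ G.hub u) (hvI : v ∉ I) : ¬ G.Prescribed u I v c := by
  rintro ⟨-, ⟨rfl, -⟩ | ⟨rfl, -⟩ | ⟨h, -⟩ | ⟨h, -⟩⟩
  · exact G.edge.irrefl hv
  · exact hc.2 rfl
  · exact hvI h
  · exact h.1.1 hv

theorem not_prescribed_of_not_isMixed (hI : I ⊆ G.hub u) {c v : V} (hc : c ∈ G.outer u)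
    (hv : v ∈ G.hub u) (hm : ¬ G.IsMixed u I c) :
    ¬ G.Prescribed u I c v ∧ ¬ G.Prescribed u I v c := by
  have hvu : v ≠ u := by rintro rfl; exact G.edge.irrefl hv
  constructor
  · rintro ⟨-, ⟨rfl, -⟩ | ⟨h, -⟩ | ⟨h, -⟩ | ⟨h, -⟩⟩
    · exact hc.2 rfl
    · exact hvu h
    · exact hc.1 (hI h)
    · exact hm h
  · rintro ⟨-, ⟨h, -⟩ | ⟨rfl, -⟩ | ⟨-, h⟩ | ⟨h, -⟩⟩
    · exact hvu h
    · exact hc.2 rfl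
    · exact hm h
    · exact h.1.1 hv

/-- Edges inside components stay undirected. Each mixed component lies on closed walks from `u`
through `I`, the component and `N \ I`, and these reach all of `N`; an unmixed component keeps its
undirected edges to `N`. -/
theorem isConnected_prescribe (hG : G.IsBridgeless) (hU : G.IsUndirected)
    (hI : G.IsColoring u I) : (G.prescribe u I hI.1).IsConnected := by
  rw [isConnected_iff]
  set R := ReflTransGen (G.prescribe u I hI.1).Step with hR
  have hout : ∀ v ∈ I, R u v := fun v hv =>
    .single (.inr ⟨hI.1 hv, .inl ⟨rfl, hv⟩⟩)
  have hin : ∀ v ∈ G.hub u, v ∉ I → R v u := fun v hv hvI =>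
    .single (.inr ⟨hv.symm, .inr (.inl ⟨rfl, hvI⟩)⟩)
  have hcu : ∀ c, G.IsMixed u I c → R c u := by
    intro c hc
    obtain ⟨w, ⟨hw, d, hd, hdw⟩, hwI⟩ := hc.2.2
    exact ((reflTransGen_prescribe_comp hI.1 hd).1.tail
      (.inr ⟨hdw, .inr (.inr (.inr ⟨hc.of_mem_comp hd, hw, hwI⟩))⟩)).trans (hin w hw hwI)
  have huc : ∀ c, G.IsMixed u I c → R u c := by
    intro c hc
    obtain ⟨v, ⟨hv, d, hd, hdv⟩, hvI⟩ := hc.2.1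
    exact (hout v hvI).trans (.head
      (.inr ⟨hdv.symm, .inr (.inr (.inl ⟨hvI, hc.of_mem_comp hd⟩))⟩)
      (reflTransGen_prescribe_comp hI.1 hd).2)
  have hvu : ∀ v ∈ G.hub u, R v u ∧ R u v := by
    intro v hv
    obtain ⟨c, ⟨-, d, hd, hdv⟩, hc⟩ := hI.2 v hv
    have hdm := hc.of_mem_comp hd
    by_cases hvI : v ∈ I
    · exact ⟨.head (step_prescribe hI.1 hdv.symm (not_prescribed_of_mem hI.1 hdm.1 hvI))
        (hcu d hdm), hout v hvI⟩
    · exact ⟨hin v hv hvI, (huc d hdm).tail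
        (step_prescribe hI.1 hdv (not_prescribed_of_notMem hI.1 hdm.1 hv hvI))⟩
  have hall : ∀ x, R x u ∧ R u x := by
    intro x
    by_cases hxu : x = u
    · subst hxu; exact ⟨.refl, .refl⟩
    by_cases hxN : x ∈ G.hub u
    · exact hvu x hxN
    have hx : x ∈ G.outer u := ⟨hxN, hxu⟩
    by_cases hm : G.IsMixed u I x
    · exact ⟨hcu x hm, huc x hm⟩
    obtain ⟨v, hv, d, hd, hdv⟩ := att_nonempty hG hU hx
    have hdm : ¬ G.IsMixed u I d := fun h => hm (h.of_mem_comp (by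
      rw [comp_eq hd]; exact mem_comp_self x))
    obtain ⟨h1, h2⟩ := not_prescribed_of_not_isMixed hI.1 (comp_subset hx hd) hv hdm
    obtain ⟨h3, h4⟩ := reflTransGen_prescribe_comp hI.1 hd
    exact ⟨(h3.tail (step_prescribe hI.1 hdv h2)).trans (hvu v hv).1,
      (hvu v hv).2.trans (.head (step_prescribe hI.1 hdv.symm h1) h4)⟩
  exact fun x y => (hall x).1.trans (hall y).2

/-- A colouring can be extended to a strong orientation. -/
theorem exists_isStrongOrientation_prescribed [Finite V] (hG : G.IsBridgeless)
    (hU : G.IsUndirected) (hI : G.IsColoring u I) :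
    ∃ D : MixedGraph V, D.IsStrongOrientation G ∧ ∀ a b, G.Prescribed u I a b → D.arc a b := by
  have h1 : ∀ x y, G.arc x y → (G.prescribe u I hI.1).arc x y := fun x y h => absurd h (hU x y)
  have h2 : ∀ x y, G.edge.Adj x y → (G.prescribe u I hI.1).edge.Adj x y ∨
      (G.prescribe u I hI.1).arc x y ∨ (G.prescribe u I hI.1).arc y x := by
    intro x y h
    by_cases hxy : G.Prescribed u I x y
    · exact .inr (.inl hxy)
    by_cases hyx : G.Prescribed u I y x
    · exact .inr (.inr hyx)
    exact .inl ⟨h, hxy, hyx⟩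
  have h4 : (G.prescribe u I hI.1).edge ≤ G.edge := fun _ _ h => h.1
  obtain ⟨D, hD, hc⟩ := (hG.of_partial_orientation (isConnected_prescribe hG hU hI)
    h1 h2 h4).exists_isStrongOrientation
  exact ⟨D, ⟨hD.trans h1 h2 (fun _ _ h => .inr h.1) h4, hc⟩, hD.arc_of_arc⟩

end MixedGraph

/-! ### Distances in an orientation that follows a colouring -/

namespace MixedGraph

variable {V : Type*} {G : MixedGraph V} {A I : Set V} {u : V} {r : V → V → Prop}

/-- The relation `r` is strongly connected and runs along the undirected edges of `G`, in the
direction prescribed by the colouring `I` of the neighbours of `u`. -/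
structure Follows (G : MixedGraph V) (u : V) (I : Set V) (r : V → V → Prop) : Prop where
  strong : ∀ x y, ReflTransGen r x y
  adj : ∀ a b, r a b → G.edge.Adj a b
  into_center : ∀ v ∈ G.hub u, v ∉ I → r v u
  out_center : ∀ v ∈ G.hub u, v ∈ I → r u v
  into_mixed : ∀ c, G.IsMixed u I c → ∀ v ∈ G.hub u, v ∈ I → G.edge.Adj c v → r v c ∧ ¬ r c v
  out_mixed : ∀ c, G.IsMixed u I c → ∀ v ∈ G.hub u, v ∉ I → G.edge.Adj c v → r c v ∧ ¬ r v c
  cover : ∀ v ∈ G.hub u, ∃ c, v ∈ G.att u c ∧ G.IsMixed u I c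

theorem isMixed_compl {c : V} : G.IsMixed u Iᶜ c ↔ G.IsMixed u I c := by
  simp only [IsMixed, Set.mem_compl_iff, not_not]
  tauto

theorem Follows.swap (h : G.Follows u I r) : G.Follows u Iᶜ (Function.swap r) where
  strong x y := reflTransGen_swap.2 (h.strong y x)
  adj a b hab := (h.adj b a hab).symm
  into_center v hv hvI := h.out_center v hv (not_not.1 hvI)
  out_center v hv hvI := h.into_center v hv hvI
  into_mixed c hc v hv hvI := h.out_mixed c (isMixed_compl.1 hc) v hv hvI
  out_mixed c hc v hv hvI := h.into_mixed c (isMixed_compl.1 hc) v hv (not_not.1 hvI)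
  cover v hv := by simpa only [isMixed_compl] using h.cover v hv

theorem Follows.exists_exit (h : G.Follows u I r) {x : V} (hx : x ∈ G.outer u) :
    ∃ v ∈ G.att u x, Via r (G.comp u x) x v ∧ (G.IsMixed u I x → v ∉ I) := by
  obtain ⟨v, hv, hvia, c, hc, hcv⟩ := exists_via_att h.adj h.strong hx
  exact ⟨v, hv, hvia, fun hm hvI =>
    (h.into_mixed c (hm.of_mem_comp hc) v hv.1 hvI (h.adj _ _ hcv)).2 hcv⟩

/-- A mixed component leads from each attachment in `I` to an attachment outside of `I`. -/
theorem Follows.exists_jump (h : G.Follows u I r) {c v : V} (hc : G.IsMixed u I c)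
    (hv : v ∈ G.att u c) (hvI : v ∈ I) :
    ∃ w ∈ G.att u c, w ∉ I ∧ Via r (G.comp u c) v w := by
  obtain ⟨hvN, d, hd, hdv⟩ := hv
  have hdm := hc.of_mem_comp hd
  obtain ⟨w, hw, hdw, hwI⟩ := h.exists_exit hdm.1
  rw [att_eq hd] at hw
  rw [comp_eq hd] at hdw
  exact ⟨w, hw, hwI hdm, Via.cons (h.into_mixed d hdm v hvN hvI hdv).1 hd hdw⟩

/-- A vertex outside `I` steps to `u`; a vertex of `I` first crosses a mixed component to one
outside `I`. -/
theorem Follows.reachIn_center (h : G.Follows u I r) {v : V} (hv : v ∈ G.hub u) :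
    ∃ s ⊆ G.hub u, s.ncard ≤ 2 ∧ v ∈ s ∧
      ReachIn r ({c | G.IsMixed u I c} ∪ insert u s) v u := by
  by_cases hvI : v ∈ I
  · obtain ⟨c, hvc, hc⟩ := h.cover v hv
    obtain ⟨w, hw, hwI, hvw⟩ := h.exists_jump hc hvc hvI
    refine ⟨{v, w}, Set.pair_subset hv hw.1, Hub.ncard_pair_le _ _, by simp, ?_⟩
    exact ((hvw.mono fun d hd => .inl (hc.of_mem_comp hd)).reachIn (by simp) (by simp)).trans
      (.single (by simp) (by simp) (h.into_center w hw.1 hwI))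
  · exact ⟨{v}, by simpa, by simp, rfl, .single (by simp) (by simp) (h.into_center v hv hvI)⟩

theorem Follows.reachIn_of_notMem (h : G.Follows u I r) {v : V} (hv : v ∈ G.hub u) (hvI : v ∉ I)
    (Y : Set V) : ReachIn r (Y ∪ insert u {v}) v u :=
  .single (by simp) (by simp) (h.into_center v hv hvI)

/-- Two vertices of `N` are needed only if the component of `x` is left at a vertex of `I`. Mixed
components are never left there, so then all attachments lie in `I`, and the walk uses only this
component and mixed ones. -/
theorem Follows.prefix_cases (h : G.Follows u I r) (hN : G.hub u ⊆ A) (x : V) :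
    (∃ s ⊆ G.hub u, s.ncard ≤ 2 ∧ ReachIn r (G.outer u ∪ insert u s) x u) ∧
    (x ∉ A → (∃ s ⊆ G.hub u, s.ncard ≤ 1 ∧ ReachIn r (G.outer u ∪ insert u s) x u) ∨
      (x ∈ G.outer u ∧ G.att u x ⊆ I ∧ ∃ s ⊆ G.hub u, s.ncard ≤ 2 ∧
        ReachIn r (G.comp u x ∪ {c | G.IsMixed u I c} ∪ insert u s) x u)) := by
  have hM : {c | G.IsMixed u I c} ⊆ G.outer u := fun c hc => hc.1
  by_cases hxu : x = u
  · subst hxu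
    have h0 : ReachIn r (G.outer x ∪ insert x ∅) x x := .refl (by simp)
    exact ⟨⟨∅, by simp, by simp, h0⟩, fun _ => .inl ⟨∅, by simp, by simp, h0⟩⟩
  by_cases hxN : x ∈ G.hub u
  · refine ⟨?_, fun hx => absurd (hN hxN) hx⟩
    obtain ⟨s, hs, hs2, -, h1⟩ := h.reachIn_center hxN
    exact ⟨s, hs, hs2, h1.mono (Set.union_subset_union_left _ hM)⟩
  have hx : x ∈ G.outer u := ⟨hxN, hxu⟩
  have hcx := comp_subset hx
  obtain ⟨v, hv, hxv, hvI⟩ := h.exists_exit hx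
  obtain ⟨s, hs, hs2, hvs, h1⟩ := h.reachIn_center hv.1
  have key : ReachIn r (G.comp u x ∪ {c | G.IsMixed u I c} ∪ insert u s) x u :=
    ((hxv.mono fun c hc => .inl (.inl hc)).reachIn (.inl (.inl (mem_comp_self x)))
      (by simp [hvs])).trans (h1.mono (Set.union_subset_union_left _ Set.subset_union_right))
  refine ⟨⟨s, hs, hs2, key.mono (Set.union_subset_union_left _ (Set.union_subset hcx hM))⟩,
    fun _ => ?_⟩
  by_cases hvI' : v ∈ I
  · refine .inr ⟨hx, fun w hw => ?_, s, hs, hs2, key⟩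
    by_contra hwI
    exact hvI ⟨hx, ⟨v, hv, hvI'⟩, w, hw, hwI⟩ hvI'
  · exact .inl ⟨{v}, by simpa using hv.1, by simp,
      ((hxv.mono fun c hc => .inl (hcx hc)).reachIn (.inl hx) (by simp)).trans
        (h.reachIn_of_notMem hv.1 hvI' _)⟩

/-- Reversing all arcs and exchanging the two colours reduces this to `Follows.prefix_cases`. -/
theorem Follows.suffix_cases (h : G.Follows u I r) (hN : G.hub u ⊆ A) (y : V) :
    (∃ s ⊆ G.hub u, s.ncard ≤ 2 ∧ ReachIn r (G.outer u ∪ insert u s) u y) ∧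
    (y ∉ A → (∃ s ⊆ G.hub u, s.ncard ≤ 1 ∧ ReachIn r (G.outer u ∪ insert u s) u y) ∨
      (y ∈ G.outer u ∧ (∀ v ∈ G.att u y, v ∉ I) ∧ ∃ s ⊆ G.hub u, s.ncard ≤ 2 ∧
        ReachIn r (G.comp u y ∪ {c | G.IsMixed u I c} ∪ insert u s) u y)) := by
  obtain ⟨⟨s, hs, hs2, h1⟩, h2⟩ := h.swap.prefix_cases hN y
  refine ⟨⟨s, hs, hs2, h1.swap⟩, fun hy => ?_⟩
  rcases h2 hy with ⟨s, hs, hs2, h1⟩ | ⟨hyo, hyI, s, hs, hs2, h1⟩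
  · exact .inl ⟨s, hs, hs2, h1.swap⟩
  · simp only [isMixed_compl] at h1
    exact .inr ⟨hyo, fun v hv => hyI hv, s, hs, hs2, h1.swap⟩

/-- A direct connection of two components through a third one. -/
theorem Follows.reachIn_direct (h : G.Follows u I r) {x y c p q : V} (hx : x ∈ G.outer u)
    (hy : y ∈ G.outer u) (hxp : G.att u x = {p}) (hyq : G.att u y = {q}) (hc : G.IsMixed u I c)
    (hcpq : G.att u c = {p, q}) (hp : p ∈ I) :
    ReachIn r (G.outer u ∪ insert u {p, q}) x y := by
  obtain ⟨v, hv, hxv, -⟩ := h.exists_exit hx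
  obtain rfl : v = p := by simpa [hxp] using hv
  obtain ⟨v', hv', hyv, -⟩ := h.swap.exists_exit hy
  obtain rfl : v' = q := by simpa [hyq] using hv'
  obtain ⟨w, hw, hwI, hvw⟩ := h.exists_jump hc (v := v) (by simp [hcpq]) hp
  rw [hcpq] at hw
  obtain rfl : w = v' := by
    rcases hw with rfl | hw
    · exact absurd hp hwI
    · exact hw
  have hmono : ∀ {z}, z ∈ G.outer u → G.comp u z ⊆ G.outer u ∪ insert u {v, w} :=
    fun hz => (comp_subset hz).trans Set.subset_union_left
  exact (((hxv.mono (hmono hx)).reachIn (.inl hx) (by simp)).trans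
    ((hvw.mono (hmono hc.1)).reachIn (by simp) (by simp))).trans
    ((hyv.swap.mono (hmono hy)).reachIn (by simp) (.inl hy))

/-- A bound for the oriented diameter of a bipartite bridgeless undirected graph in terms of the
degree of a vertex outside of the part `A`. -/
theorem exists_isStrongOrientation_dist_add_one_le [Finite V] (hG : G.IsBridgeless)
    (hU : G.IsUndirected) (hA : ∀ a b, G.edge.Adj a b → (a ∈ A ↔ b ∉ A)) (hu : u ∉ A) :
    ∃ D : MixedGraph V, D.IsStrongOrientation G ∧
      ∀ x y, D.dist x y + 1 ≤ (2 * (A.ncard - G.undirDegree u + 4) : ℕ) := by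
  classical
  obtain ⟨I, hI, hpair⟩ := exists_isColoring hG hU hA hu
  obtain ⟨D, hD, hDp⟩ := exists_isStrongOrientation_prescribed hG hU hI
  have hN := hub_subset hA hu
  have hadj : ∀ a b, D.Step a b → G.edge.Adj a b := by
    intro a b h
    rcases hD.1.adj_of_step h with h | h | h
    · exact h
    · exact absurd h (hU _ _)
    · exact absurd h (hU _ _)
  have hasymm : ∀ a b, G.Prescribed u I a b → D.Step a b ∧ ¬ D.Step b a := fun a b h =>
    ⟨.inr (hDp a b h), fun h' => D.arc_asymm _ _ (hDp a b h)
      ((step_iff_of_isDirected hD.1.isDirected).1 h')⟩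
  have hF : G.Follows u I D.Step :=
    { strong := isConnected_iff.1 hD.2
      adj := hadj
      into_center := fun v hv hvI => (hasymm v u ⟨hv.symm, .inr (.inl ⟨rfl, hvI⟩)⟩).1
      out_center := fun v hv hvI => (hasymm u v ⟨hv, .inl ⟨rfl, hvI⟩⟩).1
      into_mixed := fun c hc v _ hvI h => hasymm v c ⟨h.symm, .inr (.inr (.inl ⟨hvI, hc⟩))⟩
      out_mixed := fun c hc v hv hvI h => hasymm c v ⟨h, .inr (.inr (.inr ⟨hc, hv, hvI⟩))⟩
      cover := hI.2 }
  have hA' : ∀ a b, D.Step a b → (a ∈ A ↔ b ∉ A) := fun a b h => hA a b (hadj a b h)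
  have hshort : ∀ {x y : V} {X : Set V}, ReachIn D.Step X x y →
      (A ∩ X).ncard ≤ A.ncard - G.undirDegree u + 3 →
      D.dist x y + 1 ≤ (2 * (A.ncard - G.undirDegree u + 4) : ℕ) := by
    intro x y X h hk
    refine (add_le_add_left (dist_le_of_reachIn hA' h hk) 1).trans ?_
    exact_mod_cast (by omega)
  have hcard : ∀ {s C W : Set V} {k : ℕ}, C ⊆ A \ G.hub u → s.ncard ≤ k →
      W ⊆ G.outer u \ C ∪ insert u s →
      (A ∩ W).ncard + C.ncard ≤ A.ncard - G.undirDegree u + k :=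
    fun hC hk hW => ncard_inter_le hN hu hC hk hW
  have hcard₀ : ∀ {s : Set V} {k : ℕ}, s.ncard ≤ k →
      (A ∩ (G.outer u ∪ insert u s)).ncard ≤ A.ncard - G.undirDegree u + k := by
    intro s k hk
    simpa using hcard (C := ∅) (by simp) hk (by simp)
  have hjoin : ∀ {Y s t : Set V} {x y : V}, ReachIn D.Step (Y ∪ insert u s) x u →
      ReachIn D.Step (Y ∪ insert u t) u y → ReachIn D.Step (Y ∪ insert u (s ∪ t)) x y := by
    intro Y s t x y h1 h2
    rw [← Hub.union_insert_union]
    exact h1.union_trans h2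
  refine ⟨D, hD, fun x y => ?_⟩
  obtain ⟨⟨s, hs, hs2, h1⟩, hx⟩ := hF.prefix_cases hN x
  obtain ⟨⟨t, ht, ht2, h2⟩, hy⟩ := hF.suffix_cases hN y
  have hst : (s ∪ t).ncard ≤ 4 := (Set.ncard_union_le s t).trans (by omega)
  -- An end in `A` saves one in the count of a path, even with four vertices of `N`.
  by_cases hxy : x ∈ A ∨ y ∈ A
  · have hd := dist_add_le_of_reachIn hA' (hjoin h1 h2)
    have hd' : D.dist x y + 1 ≤
        D.dist x y + ((if x ∈ A then 1 else 0) + (if y ∈ A then 1 else 0) : ℕ) := by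
      refine add_le_add_right ?_ _
      rcases hxy with h | h <;> simp [h]
    refine (hd'.trans hd).trans ?_
    exact_mod_cast Nat.mul_le_mul_left 2 (hcard₀ hst)
  rw [not_or] at hxy
  rcases hx hxy.1 with ⟨s', hs', hs1', h1'⟩ | ⟨hxo, hxI, s', hs', hs2', h1'⟩
  · exact hshort (hjoin h1' h2) (hcard₀ ((Set.ncard_union_le s' t).trans (by omega)))
  rcases hy hxy.2 with ⟨t', ht', ht1', h2'⟩ | ⟨hyo, hyI, t', ht', ht2', h2'⟩
  · exact hshort (hjoin h1 h2') (hcard₀ ((Set.ncard_union_le s t').trans (by omega)))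
  -- The only expensive pairs: four vertices of `N` with a missed `m ∈ A`, or a shortcut with just
  -- the two attachments.
  rcases hpair x hxo y hyo hxI hyI with ⟨m, hmA, hmo, hmx, hmy, hmM⟩ | ⟨c, p, q, hc, hp, hq, hpq⟩
  · have hc := hcard (C := {m}) (s := s' ∪ t') (k := 4) (by simpa using ⟨hmA, hmo.1⟩)
      ((Set.ncard_union_le s' t').trans (by omega)) subset_rfl
    rw [Set.ncard_singleton] at hc
    refine hshort (X := G.outer u \ {m} ∪ insert u (s' ∪ t')) (hjoin
      (h1'.mono (Set.union_subset_union_left _ ?_))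
      (h2'.mono (Set.union_subset_union_left _ ?_))) (by omega)
    · rintro d (hd | hd)
      · exact ⟨comp_subset hxo hd, by rintro rfl; exact hmx hd⟩
      · exact ⟨hd.1, by rintro rfl; exact hmM hd⟩
    · rintro d (hd | hd)
      · exact ⟨comp_subset hyo hd, by rintro rfl; exact hmy hd⟩
      · exact ⟨hd.1, by rintro rfl; exact hmM hd⟩
  · exact hshort (hF.reachIn_direct hxo hyo hp hq hc hpq (hxI (by simp [hp])))
      (hcard₀ ((Hub.ncard_pair_le p q).trans (by norm_num)))

theorem diam_le {D : MixedGraph V} {b : ℕ∞} (h : ∀ x y, D.dist x y ≤ b) : D.diam ≤ b :=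
  iSup₂_le h

theorem IsStrongOrientation.orientedDiam_le {D : MixedGraph V} (hD : D.IsStrongOrientation G)
    {b : ℕ∞} (h : ∀ x y, D.dist x y ≤ b) : G.orientedDiam ≤ b :=
  (iInf₂_le D hD).trans (diam_le h)

end MixedGraph

/-! ### Conclusion -/

open MixedGraph in
theorem corollary1p6 {V : Type*} [Fintype V] (G : MixedGraph V)
    (hbridgeless : G.IsBridgeless) (hbip : G.IsEqualPartitionBipartite) :
    ∃ d : ℕ, G.orientedDiam = (d : ℕ∞) ∧
      (G.IsUndirected →
        (d : ℤ) ≤ (Fintype.card V : ℤ) - 2 * (G.maxUndirDegree : ℤ) + 7) ∧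
      ((∃ u : V, G.undirDegree u = G.maxUndirDegree ∧ 2 ≤ G.outDegree u + G.inDegree u) →
        (d : ℤ) ≤ (Fintype.card V : ℤ) - 2 * (G.maxUndirDegree : ℤ) + 8) ∧
      (¬ G.IsUndirected →
        (¬ ∃ u : V, G.undirDegree u = G.maxUndirDegree ∧ 2 ≤ G.outDegree u + G.inDegree u) →
        (d : ℤ) ≤ (Fintype.card V : ℤ) - 2 * (G.maxUndirDegree : ℤ) + 10) := by
  have hside : ∀ u : V, ∃ A : Set V, 2 * A.ncard = Fintype.card V ∧ u ∉ A ∧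
      G.undirDegree u ≤ A.ncard ∧ ∀ a b, G.underlying.Adj a b → (a ∈ A ↔ b ∉ A) := by
    obtain ⟨A, B, hAB, huniv, hcard⟩ := hbip
    have hn : A.ncard + B.ncard = Fintype.card V := by
      rw [← Set.ncard_union_eq hAB.disjoint, huniv, Set.ncard_univ, Nat.card_eq_fintype_card]
    have hdis := Set.disjoint_left.1 hAB.disjoint
    have hmem : ∀ x, x ∈ A ∨ x ∈ B := fun x => by
      rw [← Set.mem_union, huniv]; trivial
    have hdeg : ∀ (C : Set V) (u : V), u ∉ C →
        (∀ a b, G.underlying.Adj a b → (a ∈ C ↔ b ∉ C)) → G.undirDegree u ≤ C.ncard :=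
      fun C u hu hC => Set.ncard_le_ncard (hub_subset (fun a b h => hC a b (.inl h)) hu)
        (Set.toFinite _)
    have hA : ∀ a b, G.underlying.Adj a b → (a ∈ A ↔ b ∉ A) := by
      intro a b hab
      rcases hAB.mem_of_adj hab with ⟨h1, h2⟩ | ⟨h1, h2⟩
      · exact ⟨fun _ h => hdis h h2, fun _ => h1⟩
      · exact ⟨fun h => absurd h1 (hdis h), fun h => absurd h2 h⟩
    have hB : ∀ a b, G.underlying.Adj a b → (a ∈ B ↔ b ∉ B) := by
      intro a b hab
      rcases hAB.mem_of_adj hab with ⟨h1, h2⟩ | ⟨h1, h2⟩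
      · exact ⟨fun h => absurd h (hdis h1), fun h => absurd h2 h⟩
      · exact ⟨fun _ h => hdis h2 h, fun _ => h1⟩
    intro u
    rcases hmem u with hu | hu
    · exact ⟨B, by omega, hdis hu, hdeg B u (hdis hu) hB, hB⟩
    · have hu' : u ∉ A := fun h => hdis h hu
      exact ⟨A, by omega, hu', hdeg A u hu' hA, hA⟩
  cases isEmpty_or_nonempty V with
  | inl hV =>
    obtain ⟨D, hD⟩ := hbridgeless.exists_isStrongOrientation
    -- Without vertices there is no centre `u`; the diameter is a supremum over the empty set, hence
    -- `0`.
    have h0 : G.orientedDiam = ((0 : ℕ) : ℕ∞) :=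
      le_antisymm (hD.orientedDiam_le fun x => isEmptyElim x) (by simp)
    have hm : G.maxUndirDegree = 0 := by simp [maxUndirDegree]
    have hc : Fintype.card V = 0 := Fintype.card_eq_zero
    refine ⟨0, h0, fun _ => ?_, fun _ => ?_, fun _ _ => ?_⟩ <;> rw [hm, hc] <;> norm_num
  | inr hV =>
    obtain ⟨u, -, hu⟩ := Finset.exists_mem_eq_sup Finset.univ Finset.univ_nonempty G.undirDegree
    have humax : G.undirDegree u = G.maxUndirDegree := hu.symm
    obtain ⟨A, hAn, huA, hdA, hA⟩ := hside u
    obtain ⟨D, hD, hD5, -⟩ := exists_isStrongOrientation_dist_le hbridgeless hA huA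
    have hle := hD.orientedDiam_le hD5
    obtain ⟨d, hd⟩ := ENat.ne_top_iff_exists.1 (ne_top_of_le_ne_top (ENat.natCast_ne_top _) hle)
    refine ⟨d, hd.symm, fun hU => ?_, ?_, fun _ _ => ?_⟩
    · obtain ⟨D', hD', h7⟩ := exists_isStrongOrientation_dist_add_one_le hbridgeless hU
        (fun a b h => hA a b (.inl h)) huA
      have hle' : G.orientedDiam ≤ ((2 * (A.ncard - G.undirDegree u + 4) - 1 : ℕ) : ℕ∞) := by
        refine hD'.orientedDiam_le fun x y => ?_
        have h := h7 x y
        obtain ⟨k, hk⟩ := ENat.ne_top_iff_exists.1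
          (ne_top_of_le_ne_top (ENat.natCast_ne_top _) (le_self_add.trans h))
        rw [← hk] at h ⊢
        have h' : k + 1 ≤ 2 * (A.ncard - G.undirDegree u + 4) := by exact_mod_cast h
        exact_mod_cast (by omega)
      rw [← hd] at hle'
      have hle'' : d ≤ 2 * (A.ncard - G.undirDegree u + 4) - 1 := by exact_mod_cast hle'
      omega
    · rintro ⟨w, hw, hw2⟩
      -- The vertex `w` may lie in the other part than `u`; equal parts give the same bound from
      -- either side.
      obtain ⟨A', hAn', hwA, hdA', hA'⟩ := hside w
      obtain ⟨D', hD', -, h4⟩ := exists_isStrongOrientation_dist_le hbridgeless hA' hwA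
      have hle' := hD'.orientedDiam_le (h4 hw2)
      rw [← hd] at hle'
      have hle'' : d ≤ 2 * (A'.ncard - G.undirDegree w + 4) := by exact_mod_cast hle'
      omega
    · rw [← hd] at hle
      have hle'' : d ≤ 2 * (A.ncard - G.undirDegree u + 5) := by exact_mod_cast hle
      omega
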